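/- A finite permutation is an arrangement $a_1a_2\cdots a_n$ of $1,\dots,n$ for some $n\ge 0$. A finite permutation $\alpha$ is involved in a finite permutation $\beta$ if $\alpha$ is order isomorphic to a subsequence of $\beta$. A set of finite permutations is closed if it contains every permutation involved in one of its elements; its basis is the set of permutations that are minimal, with respect to involvement, subject to not lying in it; it is finitely based if its basis is finite. For a set $C$ of finite permutations, $\mathcal{A}(C)$ is the set of finite permutations that involve no element of $C$. For a finite permutation $\gamma$, $\mathrm{Sub}(\gamma)$ is the set of permutations involved in $\gamma$; for a permutation $\pi$ of $\mathbb{N}$ (a bijection $\mathbb{N}\to\mathbb{N}$), $\mathrm{Sub}(\pi)$ is the set of finite permutations order isomorphic to finite subsequences of $\pi(1),\pi(2),\dots$. The sum $\alpha\oplus\beta$ of finite permutations is $\alpha$ followed by the copy of $\beta$ with all values increased by $|\alpha|$; for sets, $Y\oplus Z=\{\sigma\oplus\tau : \sigma\in Y,\ \tau\in Z\}$; a set $Y$ is sum-complete if $Y\oplus Y\subseteq Y$. Every nonempty finite permutation is uniquely a sum of nonempty permutations that are not themselves sums of two nonempty permutations; these are its sum components. **Theorem 3.1.** Let $X$ be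 a finitely based natural class, i.e. $X=\mathrm{Sub}(\pi_0)$ for some permutation $\pi_0$ of $\mathbb{N}$, and the basis of $X$ is finite. Let $C$ be the set of final sum components of the basis elements of $X$. Then at least one of the following holds. 1. There is a finite permutation $\gamma$ with $X=\mathrm{Sub}(\gamma)\oplus S$, where $S=\mathcal{A}(C)$; the set $S$ is closed and sum-complete, and it is determined uniquely by $X$: if $X=\mathrm{Sub}(\gamma')\oplus S'$ with $\gamma'$ a finite permutation and $S'$ a sum-complete closed set, then $S'=S$. 2. There is exactly one permutation $\pi$ of $\mathbb{N}$ with $X=\mathrm{Sub}(\pi)$, and this $\pi$ is ultimately periodic: there are integers $N$ and $P>0$ such that $\pi(n+P)=\pi(n)+P$ for all $n\ge N$. Moreover, whenever (2) holds, the ordinary generating function $\sum_{n\ge 0}|\{\sigma\in X : |\sigma|=n\}|\,x^n$ is rational. -/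

import Mathlib

namespace PermClass

/-- A finite permutation: an arrangement of `n` values for some `n ≥ 0`. Positions and values are
numbered `0, …, n - 1`; the empty permutation (`n = 0`) is included. -/
abbrev FinPerm : Type := Σ n : ℕ, Equiv.Perm (Fin n)

/-- `α` is involved in `β`: `α` is order isomorphic to a subsequence of `β`. -/
def Involved (α β : FinPerm) : Prop :=
  ∃ f : Fin α.1 ↪o Fin β.1, ∀ i j, α.2 i < α.2 j ↔ β.2 (f i) < β.2 (f j)

/-- The set of finite permutations involved in the finite permutation `γ`. -/
def Sub (γ : FinPerm) : Set FinPerm := {α | Involved α γ}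

/-- The set of finite permutations that are order isomorphic to a finite subsequence of
`π 0, π 1, π 2, …`, where `π` is a permutation of the natural numbers. -/
def SubNat (π : Equiv.Perm ℕ) : Set FinPerm :=
  {α | ∃ f : Fin α.1 ↪o ℕ, ∀ i j, α.2 i < α.2 j ↔ π (f i) < π (f j)}

/-- A set of permutations is closed if it is downward closed under involvement. -/
def IsClosedClass (X : Set FinPerm) : Prop :=
  ∀ α ∈ X, ∀ δ, Involved δ α → δ ∈ X

/-- A natural class is a set of the form `Sub(π)` with `π` a permutation of `ℕ`. -/
def IsNaturalClass (X : Set FinPerm) : Prop :=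
  ∃ π : Equiv.Perm ℕ, X = SubNat π

/-- The basis of `X`: the permutations that are minimal subject to not lying in `X`. -/
def basis (X : Set FinPerm) : Set FinPerm :=
  {β | β ∉ X ∧ ∀ α, Involved α β → α ∉ X → α = β}

/-- `X` is finitely based if its basis is finite. -/
def IsFinitelyBased (X : Set FinPerm) : Prop := (basis X).Finite

/-- The set of all permutations that avoid every element of `C`. -/
def Av (C : Set FinPerm) : Set FinPerm :=
  {σ | ∀ γ ∈ C, ¬ Involved γ σ}

/-- The direct sum `α ⊕ β`: `α` on the first `|α|` positions and values, followed by a copy of `β`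
on the remaining positions and values. -/
def dsum (α β : FinPerm) : FinPerm :=
  ⟨α.1 + β.1, finSumFinEquiv.permCongr (Equiv.sumCongr α.2 β.2)⟩

/-- The direct sum of two sets of permutations. -/
def dsumSet (X Y : Set FinPerm) : Set FinPerm :=
  {ρ | ∃ σ ∈ X, ∃ τ ∈ Y, ρ = dsum σ τ}

/-- `X` is sum-complete if it is closed under direct sums. -/
def IsSumComplete (X : Set FinPerm) : Prop :=
  ∀ α ∈ X, ∀ β ∈ X, dsum α β ∈ X

/-- `α` is not a direct sum of two nonempty permutations. -/
def IsIndecomposable (α : FinPerm) : Prop :=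
  ∀ σ τ, α = dsum σ τ → σ.1 = 0 ∨ τ.1 = 0

/-- The final sum components of the basis elements of `X`: the nonempty indecomposable `γ` such that
some basis element has the form `β ⊕ γ` (`β` is empty when the basis element is itself
indecomposable). -/
def finalComponents (X : Set FinPerm) : Set FinPerm :=
  {γ | γ.1 ≠ 0 ∧ IsIndecomposable γ ∧ ∃ β, dsum β γ ∈ basis X}

/-- `π` is ultimately periodic: `π (n + P) = π n + P` for some `P > 0` and all large `n`. This does
not depend on whether positions and values are numbered from `0` or from `1`. -/
def IsUltimatelyPeriodic (π : Equiv.Perm ℕ) : Prop :=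
  ∃ N P : ℕ, 0 < P ∧ ∀ n ≥ N, π (n + P) = π n + P

/-- `X = Sub(π)` for exactly one permutation `π` of `ℕ`, and this `π` is ultimately periodic. -/
def IsUniquelyPeriodic (X : Set FinPerm) : Prop :=
  ∃ π : Equiv.Perm ℕ, X = SubNat π ∧ (∀ π' : Equiv.Perm ℕ, X = SubNat π' → π' = π) ∧
    IsUltimatelyPeriodic π

/-- The number of permutations of length `n` in `X`. -/
noncomputable def count (X : Set FinPerm) (n : ℕ) : ℕ :=
  Nat.card {σ : Equiv.Perm (Fin n) // (⟨n, σ⟩ : FinPerm) ∈ X}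

/-- The ordinary generating function `∑ n, count X n * x ^ n` is a quotient `p / q` of polynomials
with `q 0 ≠ 0`. -/
def HasRationalGF (X : Set FinPerm) : Prop :=
  ∃ p q : Polynomial ℚ, q.coeff 0 ≠ 0 ∧
    (q : PowerSeries ℚ) * PowerSeries.mk (fun n => (count X n : ℚ)) = (p : PowerSeries ℚ)

end PermClass

/-! Let C be the set of final components and S = A(C). In an occurrence of a basis element δ ⊕ c,
everything belonging to δ lies below and to the left of c. Membership in X is therefore controlled
near occurrences of components c (`age_subset_of_local`). This gives X ⊕ S ⊆ X. Since δ itself lies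
in X, it also shows that c cannot occur far out in π (`exists_tail_subset_av`).

The dichotomy is a compactness argument. Given a sequence generating X, embeddings of its longer and
longer prefixes into π either have a limit, or the sequence has a cut past which the images escape
to infinity (`exists_limit`). Escape means that the part past the cut avoids C, which gives the
first alternative (`splits_of_cut`). If X does not split there is always a limit. Then π has no
self-embedding but the identity, has no proper extension inside X, and is the only permutation
generating X.

Periodicity comes from two surgeries on π, both kept inside X by the local criterion. First, if
degrees in the inversion graph were unbounded, a fan at the end of a long geodesic could be
exchanged for a much larger fan of the same local type. Rigidity of the start of π forces the end of
the geodesic into a fixed finite ball, where degrees are bounded (`exists_degree_bound`). So π has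
bounded displacement and some long window repeats. Second, cutting out the stretch between two
copies of the window gives a sequence ρ. If an embedding of a long prefix of ρ into π skipped an
early point, a point could be inserted into π within X, which is impossible (`splice_rigid`). Hence
ρ = π, and this equality is the periodicity.

For the generating function, bounded displacement bounds the Lehmer code. A finite automaton that
builds permutations by prepending entries then recognises X, and its transfer matrix gives a
rational series. -/

namespace PermClass

/-! ### Occurrences of patterns among points with positions and values -/

variable {ι κ P Q P' Q' : Type*} [LinearOrder P] [LinearOrder Q] [LinearOrder P'] [LinearOrder Q']

/-- `f` is an occurrence of `α` among points with position `p` and value `q`. -/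
def IsOcc (α : FinPerm) (p : ι → P) (q : ι → Q) (f : Fin α.1 → ι) : Prop :=
  (∀ i j, i < j → p (f i) < p (f j)) ∧ ∀ i j, α.2 i < α.2 j → q (f i) < q (f j)

/-- The permutations occurring among the points of `E`. -/
def Age (p : ι → P) (q : ι → Q) (E : Set ι) : Set FinPerm :=
  {α | ∃ f, (∀ i, f i ∈ E) ∧ IsOcc α p q f}

section occ

variable {α : FinPerm} {p : ι → P} {q : ι → Q} {f : Fin α.1 → ι}

theorem IsOcc.pos_iff (h : IsOcc α p q f) (i j : Fin α.1) : p (f i) < p (f j) ↔ i < j :=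
  StrictMono.lt_iff_lt (f := fun i => p (f i)) (fun i j hij => h.1 i j hij)

/-- An occurrence only asks for forward implications. The converse is automatic because both sides
are linearly ordered. -/
theorem IsOcc.val_iff (h : IsOcc α p q f) (i j : Fin α.1) :
    q (f i) < q (f j) ↔ α.2 i < α.2 j := by
  have := StrictMono.lt_iff_lt (f := fun i => q (f (α.2.symm i)))
    (fun i j hij => h.2 _ _ (by simpa using hij)) (a := α.2 i) (b := α.2 j)
  simpa using this

theorem IsOcc.injective (h : IsOcc α p q f) : Function.Injective f := by
  intro i j hij
  by_contra hne
  rcases lt_or_gt_of_ne hne with hlt | hlt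
  · exact absurd (h.1 _ _ hlt) (by simp [hij])
  · exact absurd (h.1 _ _ hlt) (by simp [hij])

theorem IsOcc.comp (h : IsOcc α p q f) {E : Set ι} (hE : ∀ i, f i ∈ E) {p' : κ → P'} {q' : κ → Q'}
    {g : ι → κ} (hp : ∀ x ∈ E, ∀ y ∈ E, p x < p y → p' (g x) < p' (g y))
    (hq : ∀ x ∈ E, ∀ y ∈ E, q x < q y → q' (g x) < q' (g y)) :
    IsOcc α p' q' (fun i => g (f i)) :=
  ⟨fun i j hij => hp _ (hE i) _ (hE j) (h.1 i j hij),
    fun i j hij => hq _ (hE i) _ (hE j) (h.2 i j hij)⟩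

end occ

theorem age_mono {p : ι → P} {q : ι → Q} {p' : κ → P'} {q' : κ → Q'} {E : Set ι} {E' : Set κ}
    (g : ι → κ) (hg : ∀ x ∈ E, g x ∈ E') (hp : ∀ x ∈ E, ∀ y ∈ E, p x < p y → p' (g x) < p' (g y))
    (hq : ∀ x ∈ E, ∀ y ∈ E, q x < q y → q' (g x) < q' (g y)) : Age p q E ⊆ Age p' q' E' := by
  rintro α ⟨f, hfE, hf⟩
  exact ⟨fun i => g (f i), fun i => hg _ (hfE i), hf.comp hfE hp hq⟩

theorem age_subset {p : ι → P} {q : ι → Q} {E E' : Set ι} (h : E ⊆ E') : Age p q E ⊆ Age p q E' :=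
  age_mono id (fun _ hx => h hx) (fun _ _ _ _ h => h) (fun _ _ _ _ h => h)

theorem involved_iff {α β : FinPerm} : Involved α β ↔ α ∈ Age (fun i : Fin β.1 => i) β.2 Set.univ := by
  constructor
  · rintro ⟨f, hf⟩
    exact ⟨f, fun _ => trivial, fun i j hij => f.strictMono hij, fun i j hij => (hf i j).1 hij⟩
  · rintro ⟨f, -, hf⟩
    exact ⟨OrderEmbedding.ofStrictMono f fun i j hij => hf.1 i j hij,
      fun i j => (hf.val_iff i j).symm⟩

theorem subNat_eq_age (π : Equiv.Perm ℕ) : SubNat π = Age (fun i : ℕ => i) π Set.univ := by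
  ext α
  constructor
  · rintro ⟨f, hf⟩
    exact ⟨f, fun _ => trivial, fun i j hij => f.strictMono hij, fun i j hij => (hf i j).1 hij⟩
  · rintro ⟨f, -, hf⟩
    exact ⟨OrderEmbedding.ofStrictMono f fun i j hij => hf.1 i j hij,
      fun i j => (hf.val_iff i j).symm⟩

theorem involved_of_isOcc {α β : FinPerm} {p : ι → P} {q : ι → Q} {f : Fin α.1 → ι}
    {g : Fin β.1 → ι} (hf : IsOcc α p q f) (hg : IsOcc β p q g) (h : ∀ i, ∃ j, g j = f i) :
    Involved α β := by
  choose k hk using h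
  rw [involved_iff]
  refine ⟨k, fun _ => trivial, fun i j hij => ?_, fun i j hij => ?_⟩
  · rw [← hg.pos_iff, hk, hk]; exact hf.1 _ _ hij
  · rw [← hg.val_iff, hk, hk]; exact hf.2 _ _ hij

theorem IsOcc.of_involved {α β : FinPerm} {p : ι → P} {q : ι → Q} {g : Fin β.1 → ι}
    (hg : IsOcc β p q g) (h : Involved α β) : ∃ f : Fin α.1 → Fin β.1, IsOcc α p q (fun i => g (f i)) := by
  rw [involved_iff] at h
  obtain ⟨f, -, hf⟩ := h
  exact ⟨f, hf.comp (E := Set.univ) (fun _ => trivial) (fun x _ y _ h => hg.1 _ _ h)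
    (fun x _ y _ h => hg.2 _ _ h)⟩

theorem isClosedClass_age (p : ι → P) (q : ι → Q) (E : Set ι) : IsClosedClass (Age p q E) := by
  rintro α ⟨g, hgE, hg⟩ δ hδ
  obtain ⟨f, hf⟩ := hg.of_involved hδ
  exact ⟨_, fun i => hgE _, hf⟩

theorem Involved.refl (α : FinPerm) : Involved α α :=
  ⟨RelEmbedding.refl _, fun _ _ => Iff.rfl⟩

theorem Involved.trans {α β γ : FinPerm} (h : Involved α β) (h' : Involved β γ) : Involved α γ := by
  rw [involved_iff] at h' ⊢
  exact isClosedClass_age _ _ _ _ h' _ h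

theorem Involved.le {α β : FinPerm} (h : Involved α β) : α.1 ≤ β.1 := by
  obtain ⟨f, -⟩ := h
  simpa using Fintype.card_le_of_injective f f.injective

theorem perm_eq_of_lt_iff {n : ℕ} {σ τ : Equiv.Perm (Fin n)} (h : ∀ i j, σ i < σ j → τ i < τ j) :
    σ = τ := by
  have hm : StrictMono (fun i => τ (σ.symm i)) := fun i j hij => h _ _ (by simpa using hij)
  let e : Fin n ≃o Fin n := hm.orderIsoOfSurjective _ (by intro i; exact ⟨σ (τ.symm i), by simp⟩)
  have he : e = OrderIso.refl _ := Subsingleton.elim _ _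
  ext i
  have h1 : e (σ i) = σ i := by rw [he]; rfl
  have h2 : e (σ i) = τ i := by
    show τ (σ.symm (σ i)) = τ i
    simp
  rw [← h2, h1]

theorem Involved.eq_of_le {α β : FinPerm} (h : Involved α β) (hle : β.1 ≤ α.1) : α = β := by
  have heq := le_antisymm h.le hle
  obtain ⟨n, σ⟩ := α
  obtain ⟨m, τ⟩ := β
  obtain rfl : n = m := heq
  obtain ⟨f, hf⟩ := h
  have hf1 : f = RelEmbedding.refl _ := by
    ext i
    have hs : Function.Surjective f := Finite.surjective_of_injective f.injective
    have he : (f.strictMono.orderIsoOfSurjective f hs) = OrderIso.refl _ := Subsingleton.elim _ _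
    have h1 : (f.strictMono.orderIsoOfSurjective f hs) i = i := by rw [he]; rfl
    exact congrArg Fin.val h1
  have : σ = τ := perm_eq_of_lt_iff fun i j hij => by
    have := (hf i j).1 hij
    rwa [hf1] at this
  rw [this]

theorem exists_perm_lt_iff {n : ℕ} (q : Fin n → Q) (hq : Function.Injective q) :
    ∃ σ : Equiv.Perm (Fin n), ∀ i j, σ i < σ j → q i < q j := by
  -- The inverse of the sorting permutation sends an index to the rank of its value.
  refine ⟨(Tuple.sort q)⁻¹, fun i j hij => ?_⟩
  have hm := Tuple.monotone_sort q
  have h1 := hm hij.le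
  simp only [Function.comp] at h1
  rw [← Equiv.Perm.mul_apply, ← Equiv.Perm.mul_apply, mul_inv_cancel] at h1
  refine lt_of_le_of_ne h1 fun h => ?_
  rw [hq h] at hij
  exact lt_irrefl _ hij

/-- Finitely many points with distinct positions and distinct values have a pattern. -/
theorem exists_pattern (p : ι → P) (q : ι → Q) (E : Finset ι) (hp : Set.InjOn p E)
    (hq : Set.InjOn q E) : ∃ (α : FinPerm) (f : Fin α.1 → ι), IsOcc α p q f ∧ (∀ i, f i ∈ E) ∧
      ∀ x ∈ E, ∃ i, f i = x := by
  classical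
  let e := (E.image p).orderIsoOfFin rfl
  have h0 : ∀ i, ∃ x ∈ E, p x = e i := fun i => Finset.mem_image.1 (e i).2
  choose f hf hfe using h0
  have hfi : Function.Injective f := fun i j hij => by
    apply e.injective; apply Subtype.ext; rw [← hfe, ← hfe, hij]
  obtain ⟨σ, hσ⟩ := exists_perm_lt_iff (fun i => q (f i))
    (fun i j hij => hfi (hq (hf i) (hf j) hij))
  refine ⟨⟨_, σ⟩, f, ⟨fun i j hij => ?_, hσ⟩, hf, fun x hx => ?_⟩
  · rw [hfe, hfe]; exact e.strictMono hij
  · refine ⟨e.symm ⟨p x, Finset.mem_image_of_mem _ hx⟩, hp (hf _) hx ?_⟩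
    rw [hfe]; simp

/-! ### Direct sums -/

/-- The inclusion of the first summand. -/
def dsumInl (σ τ : FinPerm) (i : Fin σ.1) : Fin (dsum σ τ).1 := Fin.castAdd τ.1 i

/-- The inclusion of the second summand. -/
def dsumInr (σ τ : FinPerm) (i : Fin τ.1) : Fin (dsum σ τ).1 := Fin.natAdd σ.1 i

theorem dsumInl_val (σ τ : FinPerm) (i : Fin σ.1) : (dsumInl σ τ i).1 = i.1 := rfl

theorem dsumInr_val (σ τ : FinPerm) (i : Fin τ.1) : (dsumInr σ τ i).1 = σ.1 + i.1 := rfl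

theorem dsum_fst (σ τ : FinPerm) : (dsum σ τ).1 = σ.1 + τ.1 := rfl

theorem dsum_inl (σ τ : FinPerm) (i : Fin σ.1) :
    (dsum σ τ).2 (dsumInl σ τ i) = dsumInl σ τ (σ.2 i) := by
  show (finSumFinEquiv.permCongr (Equiv.sumCongr σ.2 τ.2)) (Fin.castAdd τ.1 i) =
    Fin.castAdd τ.1 (σ.2 i)
  simp [Equiv.permCongr_apply]

theorem dsum_inr (σ τ : FinPerm) (i : Fin τ.1) :
    (dsum σ τ).2 (dsumInr σ τ i) = dsumInr σ τ (τ.2 i) := by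
  show (finSumFinEquiv.permCongr (Equiv.sumCongr σ.2 τ.2)) (Fin.natAdd σ.1 i) =
    Fin.natAdd σ.1 (τ.2 i)
  simp [Equiv.permCongr_apply]

theorem dsum_cases {σ τ : FinPerm} {M : Fin (dsum σ τ).1 → Prop} (hl : ∀ i, M (dsumInl σ τ i))
    (hr : ∀ i, M (dsumInr σ τ i)) (i : Fin (dsum σ τ).1) : M i :=
  Fin.addCases (motive := M) hl hr i

/-- The map out of a direct sum given by maps out of the summands. -/
def dsumElim (σ τ : FinPerm) (f : Fin σ.1 → ι) (g : Fin τ.1 → ι) : Fin (dsum σ τ).1 → ι :=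
  fun i => Fin.addCases (motive := fun _ => ι) f g i

theorem dsumElim_inl (σ τ : FinPerm) (f : Fin σ.1 → ι) (g : Fin τ.1 → ι) (i : Fin σ.1) :
    dsumElim σ τ f g (dsumInl σ τ i) = f i :=
  Fin.addCases_left (motive := fun _ => ι) i

theorem dsumElim_inr (σ τ : FinPerm) (f : Fin σ.1 → ι) (g : Fin τ.1 → ι) (i : Fin τ.1) :
    dsumElim σ τ f g (dsumInr σ τ i) = g i :=
  Fin.addCases_right (motive := fun _ => ι) i

theorem isOcc_dsum {σ τ : FinPerm} {p : ι → P} {q : ι → Q} {f : Fin (dsum σ τ).1 → ι} :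
    IsOcc (dsum σ τ) p q f ↔ IsOcc σ p q (fun i => f (dsumInl σ τ i)) ∧
      IsOcc τ p q (fun i => f (dsumInr σ τ i)) ∧
      ∀ i j, p (f (dsumInl σ τ i)) < p (f (dsumInr σ τ j)) ∧
        q (f (dsumInl σ τ i)) < q (f (dsumInr σ τ j)) := by
  constructor
  · intro h
    refine ⟨⟨fun i j hij => h.1 _ _ ?_, fun i j hij => h.2 _ _ ?_⟩,
      ⟨fun i j hij => h.1 _ _ ?_, fun i j hij => h.2 _ _ ?_⟩,
      fun i j => ⟨h.1 _ _ ?_, h.2 _ _ ?_⟩⟩ <;>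
    (try rw [Fin.lt_def] at hij) <;>
    simp only [dsum_inl, dsum_inr, Fin.lt_def, dsumInl_val, dsumInr_val] <;> omega
  · rintro ⟨h1, h2, h3⟩
    constructor
    · refine dsum_cases (fun i => ?_) (fun i => ?_) <;>
        refine dsum_cases (fun j => ?_) (fun j => ?_) <;> intro hij <;>
        simp only [Fin.lt_def, dsumInl_val, dsumInr_val] at hij
      · exact h1.1 _ _ hij
      · exact (h3 i j).1
      · omega
      · exact h2.1 _ _ (by simp only [Fin.lt_def]; omega)
    · refine dsum_cases (fun i => ?_) (fun i => ?_) <;>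
        refine dsum_cases (fun j => ?_) (fun j => ?_) <;> intro hij <;>
        simp only [dsum_inl, dsum_inr, Fin.lt_def, dsumInl_val, dsumInr_val] at hij
      · exact h1.2 _ _ hij
      · exact (h3 i j).2
      · omega
      · exact h2.2 _ _ (by simp only [Fin.lt_def]; omega)

/-- Occurrences of `σ` and `τ`, the second above and to the right of the first, combine. -/
theorem dsum_mem_age {σ τ : FinPerm} {p : ι → P} {q : ι → Q} {f : Fin σ.1 → ι}
    {g : Fin τ.1 → ι} (hf : IsOcc σ p q f) (hg : IsOcc τ p q g)
    (h : ∀ i j, p (f i) < p (g j) ∧ q (f i) < q (g j)) {E : Set ι} (hfE : ∀ i, f i ∈ E)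
    (hgE : ∀ i, g i ∈ E) : dsum σ τ ∈ Age p q E := by
  refine ⟨dsumElim σ τ f g, dsum_cases (fun i => ?_) (fun i => ?_), ?_⟩
  · rw [dsumElim_inl]; exact hfE i
  · rw [dsumElim_inr]; exact hgE i
  · rw [isOcc_dsum]
    simpa only [dsumElim_inl, dsumElim_inr] using ⟨hf, hg, h⟩

/-- Cutting a permutation where no inversion crosses. -/
theorem exists_eq_dsum (α : FinPerm) (w : ℕ) (hw : w ≤ α.1)
    (h : ∀ i j : Fin α.1, i.1 < w → w ≤ j.1 → α.2 i < α.2 j) :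
    ∃ σ τ, α = dsum σ τ ∧ σ.1 = w := by
  let l : Fin w → Fin α.1 := Fin.castLE hw
  let r : Fin (α.1 - w) → Fin α.1 := fun i => ⟨w + i, by omega⟩
  obtain ⟨σ, hσ⟩ := exists_perm_lt_iff (fun i : Fin w => α.2 (l i))
    (α.2.injective.comp (Fin.castLE_injective hw))
  obtain ⟨τ, hτ⟩ := exists_perm_lt_iff (fun i => α.2 (r i)) (α.2.injective.comp (fun i j hij => by
    simp only [r, Fin.mk.injEq] at hij; ext; omega))
  refine ⟨⟨w, σ⟩, ⟨_, τ⟩, (Involved.eq_of_le ?_ (by simp only [dsum_fst]; omega)).symm, rfl⟩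
  rw [involved_iff]
  refine dsum_mem_age (σ := ⟨w, σ⟩) (τ := ⟨_, τ⟩) (f := l) (g := r)
    ⟨fun i j hij => by rw [Fin.lt_def] at hij ⊢; exact hij, hσ⟩
    ⟨fun i j hij => by rw [Fin.lt_def] at hij ⊢; exact Nat.add_lt_add_left hij w, hτ⟩ (fun i j => ⟨?_, ?_⟩)
    (fun _ => trivial) (fun _ => trivial)
  · have := i.2
    simp only [l, r, Fin.lt_def, Fin.val_castLE] at this ⊢; omega
  · exact h _ _ (by simp [l]) (by simp [r])

theorem dsum_assoc (ρ σ τ : FinPerm) : dsum (dsum ρ σ) τ = dsum ρ (dsum σ τ) := by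
  refine Involved.eq_of_le ?_ (by simp only [dsum_fst]; omega)
  rw [involved_iff]
  have hid : IsOcc (dsum ρ (dsum σ τ)) (fun i => i) (dsum ρ (dsum σ τ)).2 (fun i => i) :=
    ⟨fun _ _ h => h, fun _ _ h => h⟩
  obtain ⟨h1, h2, h3⟩ := isOcc_dsum.1 hid
  obtain ⟨h4, h5, h6⟩ := isOcc_dsum.1 h2
  refine dsum_mem_age (f := dsumElim ρ σ (dsumInl _ _) (fun i => dsumInr _ _ (dsumInl _ _ i)))
    (isOcc_dsum.2 ?_) h5 ?_ (fun _ => trivial) (fun _ => trivial)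
  · simp only [dsumElim_inl, dsumElim_inr]
    exact ⟨h1, h4, fun i j => h3 _ _⟩
  · intro i j
    revert i
    refine dsum_cases (fun i => ?_) (fun i => ?_)
    · rw [dsumElim_inl]; exact h3 _ _
    · rw [dsumElim_inr]; exact h6 _ _

theorem IsIndecomposable.exists_inversion {c : FinPerm} (hc : IsIndecomposable c) {w : ℕ}
    (hw : 0 < w) (hw' : w < c.1) : ∃ i j : Fin c.1, i.1 < w ∧ w ≤ j.1 ∧ c.2 j < c.2 i := by
  by_contra! h
  obtain ⟨σ, τ, hστ, hσ⟩ := exists_eq_dsum c w hw'.le fun i j hi hj =>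
    lt_of_le_of_ne (h i j hi hj) fun he => by
      have := c.2.injective he
      omega
  have h2 : c.1 = σ.1 + τ.1 := by rw [hστ]; rfl
  rcases hc σ τ hστ with h | h <;> omega

/-- The inversion graph of an indecomposable permutation is connected. -/
theorem IsIndecomposable.exists_crossing {c : FinPerm} (hc : IsIndecomposable c)
    (A : Fin c.1 → Prop) {a b : Fin c.1} (ha : A a) (hb : ¬ A b) :
    ∃ i j, i < j ∧ c.2 j < c.2 i ∧ ¬ (A i ↔ A j) := by
  classical
  by_contra! h
  have hn : 0 < c.1 := by have := a.2; omega
  wlog h0 : A ⟨0, hn⟩ generalizing A a b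
  · exact this (fun i => ¬ A i) (a := b) (b := a) hb (by simpa using ha)
      (fun i j hij hji => by simpa using not_congr (h i j hij hji)) h0
  let v := Finset.univ.filter (fun i => ¬ A i)
  have hv : v.Nonempty := ⟨b, by simp [v, hb]⟩
  have hm : ¬ A (v.min' hv) := (Finset.mem_filter.1 (v.min'_mem hv)).2
  have hlt : ∀ i, i < v.min' hv → A i := fun i hi => by
    by_contra hA
    exact absurd (v.min'_le i (by simp [v, hA])) (not_le.2 hi)
  have h1 : ∀ i j, i < j → ¬ (A i ↔ A j) → c.2 i < c.2 j := fun i j hij hA => by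
    by_contra hcon
    refine hA (h i j hij (lt_of_le_of_ne (not_lt.1 hcon) fun he => ?_))
    exact absurd (c.2.injective he) hij.ne'
  have hpos : 0 < (v.min' hv).1 := by
    by_contra h00
    have : v.min' hv = ⟨0, hn⟩ := Fin.ext (by simp only; omega)
    rw [this] at hm
    exact hm h0
  -- Let m be the least point outside `A`. Points on different sides of `A` are never inverted, so i
  -- lies below m. An inversion across m then fails whether j is in `A` (i below m, m below j) or
  -- not.
  obtain ⟨i, j, hi, hj, hji⟩ := hc.exists_inversion hpos (v.min' hv).2
  have hiA := hlt i hi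
  have him : c.2 i < c.2 (v.min' hv) := h1 _ _ hi (by tauto)
  by_cases hjA : A j
  · have hj' : v.min' hv < j := lt_of_le_of_ne hj fun he => hm (he ▸ hjA)
    exact lt_asymm hji (him.trans (h1 _ _ hj' (by tauto)))
  · exact lt_asymm hji (h1 i j (lt_of_lt_of_le hi hj) (by tauto))

/-- Every nonempty permutation has a final sum component. -/
theorem exists_finalComponent (β : FinPerm) (hβ : β.1 ≠ 0) :
    ∃ δ c, β = dsum δ c ∧ c.1 ≠ 0 ∧ IsIndecomposable c := by
  classical
  let P : ℕ → Prop := fun m => ∃ δ c, β = dsum δ c ∧ c.1 = m ∧ c.1 ≠ 0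
  have hP : ∃ m, P m := by
    obtain ⟨σ, τ, h, h0⟩ := exists_eq_dsum β 0 (Nat.zero_le _) (by intros; omega)
    refine ⟨_, σ, τ, h, rfl, ?_⟩
    have : β.1 = σ.1 + τ.1 := by rw [h]; rfl
    omega
  obtain ⟨δ, c, h, hm, hc⟩ := Nat.find_spec hP
  refine ⟨δ, c, h, hc, fun σ τ hστ => ?_⟩
  by_contra! hne
  have hlen : c.1 = σ.1 + τ.1 := by rw [hστ]; rfl
  have : P τ.1 := by
    exact ⟨dsum δ σ, τ, by rw [h, hστ, dsum_assoc], rfl, hne.2⟩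
  exact absurd (Nat.find_min' hP this) (by omega)

/-- Induction on size: being properly involved strictly decreases the size, so a minimal permutation
outside `X` is reached. -/
theorem exists_basis_involved {X : Set FinPerm} (α : FinPerm) (hα : α ∉ X) :
    ∃ β ∈ basis X, Involved β α := by
  obtain ⟨n, hn⟩ : ∃ n, α.1 = n := ⟨_, rfl⟩
  induction n using Nat.strong_induction_on generalizing α with
  | _ n ih =>
    by_cases h : ∃ δ, Involved δ α ∧ δ ∉ X ∧ δ ≠ α
    · obtain ⟨δ, hδ, hδX, hne⟩ := h
      have hlt : δ.1 < α.1 := lt_of_not_ge fun hge => hne (hδ.eq_of_le hge)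
      obtain ⟨β, hβ, hβδ⟩ := ih δ.1 (hn ▸ hlt) δ hδX rfl
      exact ⟨β, hβ, hβδ.trans hδ⟩
    · push Not at h
      exact ⟨α, ⟨hα, h⟩, Involved.refl α⟩

end PermClass

namespace PermClass

variable {ι κ P Q P' Q' : Type*} [LinearOrder P] [LinearOrder Q] [LinearOrder P'] [LinearOrder Q']

/-! ### Closed classes and the final components of their bases -/

theorem isClosedClass_subNat (π : Equiv.Perm ℕ) : IsClosedClass (SubNat π) := by
  rw [subNat_eq_age]; exact isClosedClass_age _ _ _

theorem isClosedClass_av (C : Set FinPerm) : IsClosedClass (Av C) :=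
  fun _ hα _ hδ γ hγ hinv => hα γ hγ (hinv.trans hδ)

/-- The inversion graph of `c` is connected, and no inversion can join a point of `A` to a point
outside it. -/
theorem IsIndecomposable.isOcc_forall_or {c : FinPerm} (hc : IsIndecomposable c) {p : ι → P}
    {q : ι → Q} {f : Fin c.1 → ι} (hf : IsOcc c p q f) (A : ι → Prop)
    (h : ∀ i j, A (f i) → ¬ A (f j) → p (f i) < p (f j) ∧ q (f i) < q (f j)) :
    (∀ i, A (f i)) ∨ ∀ i, ¬ A (f i) := by
  by_contra! hcon
  obtain ⟨⟨b, hb⟩, a, ha⟩ := hcon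
  obtain ⟨i, j, hij, hji, hA⟩ := hc.exists_crossing (fun i => A (f i)) ha hb
  by_cases hAi : A (f i)
  · exact lt_asymm hji ((hf.val_iff _ _).1 (h i j hAi (by tauto)).2)
  · exact lt_asymm hij ((hf.pos_iff _ _).1 (h j i (by tauto) hAi).1)

theorem dsum_isOcc_inl (σ τ : FinPerm) :
    IsOcc σ (fun i : Fin (dsum σ τ).1 => i) (dsum σ τ).2 (dsumInl σ τ) :=
  (isOcc_dsum (f := fun i => i).1 ⟨fun _ _ h => h, fun _ _ h => h⟩).1

theorem dsum_isOcc_inr (σ τ : FinPerm) :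
    IsOcc τ (fun i : Fin (dsum σ τ).1 => i) (dsum σ τ).2 (dsumInr σ τ) :=
  (isOcc_dsum (f := fun i => i).1 ⟨fun _ _ h => h, fun _ _ h => h⟩).2.1

theorem dsum_inl_lt_inr (σ τ : FinPerm) (i : Fin σ.1) (j : Fin τ.1) :
    dsumInl σ τ i < dsumInr σ τ j ∧ (dsum σ τ).2 (dsumInl σ τ i) < (dsum σ τ).2 (dsumInr σ τ j) :=
  (isOcc_dsum (p := fun i : Fin (dsum σ τ).1 => i) (f := fun i => i).1
    ⟨fun _ _ h => h, fun _ _ h => h⟩).2.2 i j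

theorem involved_dsum_left (σ τ : FinPerm) : Involved σ (dsum σ τ) :=
  involved_iff.2 ⟨_, fun _ => trivial, dsum_isOcc_inl σ τ⟩

theorem involved_dsum_right (σ τ : FinPerm) : Involved τ (dsum σ τ) :=
  involved_iff.2 ⟨_, fun _ => trivial, dsum_isOcc_inr σ τ⟩

/-- An indecomposable permutation occurring in a direct sum occurs in one of the summands. -/
theorem IsIndecomposable.range_subset_or {c σ τ : FinPerm} (hc : IsIndecomposable c)
    {f : Fin c.1 → Fin (dsum σ τ).1} (hf : IsOcc c (fun i => i) (dsum σ τ).2 f) :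
    (∀ i, ∃ j, dsumInl σ τ j = f i) ∨ ∀ i, ∃ j, dsumInr σ τ j = f i := by
  have hA : ∀ x, (∃ j, dsumInl σ τ j = x) ∨ ∃ j, dsumInr σ τ j = x :=
    dsum_cases (fun i => Or.inl ⟨i, rfl⟩) (fun i => Or.inr ⟨i, rfl⟩)
  rcases hc.isOcc_forall_or hf (fun x => ∃ j, dsumInl σ τ j = x) (fun i j hi hj => by
      obtain ⟨u, hu⟩ := hi
      obtain ⟨v, hv⟩ := (hA (f j)).resolve_left hj
      rw [← hu, ← hv]
      exact dsum_inl_lt_inr σ τ u v) with h | h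
  · exact Or.inl h
  · exact Or.inr fun i => (hA (f i)).resolve_left (h i)

theorem isSumComplete_av_finalComponents (X : Set FinPerm) :
    IsSumComplete (Av (finalComponents X)) := by
  intro σ hσ τ hτ c hc hinv
  obtain ⟨f, -, hf⟩ := involved_iff.1 hinv
  rcases hc.2.1.range_subset_or hf with h | h
  · exact hσ c hc (involved_of_isOcc hf (dsum_isOcc_inl σ τ) h)
  · exact hτ c hc (involved_of_isOcc hf (dsum_isOcc_inr σ τ) h)

theorem empty_involved {β : FinPerm} (hβ : β.1 = 0) (α : FinPerm) : Involved β α := by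
  rw [involved_iff]
  refine ⟨fun i => absurd i.2 (by omega), fun _ => trivial, fun i => ?_, fun i => ?_⟩ <;>
    exact absurd i.2 (by omega)

/-- A criterion for a set of points to have all its patterns in a closed class: each occurrence of a
final component, together with everything below and to the left of it, lies in a good set. -/
theorem age_subset_of_local {X : Set FinPerm} (hX : IsClosedClass X) (hne : X.Nonempty) {p : ι → P}
    {q : ι → Q} {E : Set ι}
    (h : ∀ c ∈ finalComponents X, ∀ f, (∀ i, f i ∈ E) → IsOcc c p q f →
      ∃ E', (∀ i, f i ∈ E') ∧ (∀ x ∈ E, (∀ i, p x < p (f i) ∧ q x < q (f i)) → x ∈ E') ∧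
        Age p q E' ⊆ X) : Age p q E ⊆ X := by
  intro α hα
  by_contra hαX
  obtain ⟨β, hβ, hβα⟩ := exists_basis_involved α hαX
  obtain ⟨g, hgE, hg⟩ := isClosedClass_age p q E α hα β hβα
  have h0 : β.1 ≠ 0 := fun h0 => by
    obtain ⟨δ, hδ⟩ := hne
    exact hβ.1 (hX δ hδ β (empty_involved h0 δ))
  obtain ⟨δ, c, rfl, hc0, hc⟩ := exists_finalComponent β h0
  -- Once the final component lies in the good set, so does the rest of the basis element, being
  -- below and to the left of it. The basis element would then belong to `X`.
  obtain ⟨h1, h2, h3⟩ := isOcc_dsum.1 hg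
  obtain ⟨E', hE', hE'', hE'X⟩ := h c ⟨hc0, hc, δ, hβ⟩ _ (fun i => hgE _) h2
  refine hβ.1 (hE'X ⟨g, dsum_cases (fun i => ?_) hE', hg⟩)
  exact hE'' _ (hgE _) fun j => h3 i j

/-- A final component occurring in the sum lies inside one summand. It cannot be `τ`, so it is `σ`,
and everything below and to the left of it is in `σ` as well. -/
theorem dsum_mem_of_mem_av {X : Set FinPerm} (hX : IsClosedClass X) {σ τ : FinPerm} (hσ : σ ∈ X)
    (hτ : τ ∈ Av (finalComponents X)) : dsum σ τ ∈ X := by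
  have : Age (fun i => i) (dsum σ τ).2 Set.univ ⊆ X := by
    refine age_subset_of_local hX ⟨σ, hσ⟩ fun c hc f _ hf => ?_
    rcases hc.2.1.range_subset_or hf with h | h
    · refine ⟨Set.range (dsumInl σ τ), h, fun x _ => ?_, ?_⟩
      · revert x
        refine dsum_cases (fun i _ _ => ⟨i, rfl⟩) (fun i _ hi => ?_)
        obtain ⟨j, hj⟩ := h ⟨0, Nat.pos_of_ne_zero hc.1⟩
        have := (hi ⟨0, Nat.pos_of_ne_zero hc.1⟩).1
        rw [← hj] at this
        exact absurd this (dsum_inl_lt_inr σ τ j i).1.le.not_gt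
      · rintro α ⟨g, hgE, hg⟩
        exact hX σ hσ α (involved_of_isOcc hg (dsum_isOcc_inl σ τ) hgE)
    · exact absurd (involved_of_isOcc hf (dsum_isOcc_inr σ τ) h) (hτ c hc)
  exact this (involved_iff.1 (Involved.refl _))

/-- A sum-complete closed second factor of a class is determined by the class. -/
theorem eq_av_finalComponents {X : Set FinPerm} (hX : IsClosedClass X) {γ : FinPerm}
    {S : Set FinPerm} (hS : IsClosedClass S) (hS' : IsSumComplete S) (h : X = dsumSet (Sub γ) S)
    (hne : X.Nonempty) : S = Av (finalComponents X) := by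
  have hSne : S.Nonempty := by
    obtain ⟨δ, hδ⟩ := hne
    rw [h] at hδ
    obtain ⟨_, _, τ, hτ, _⟩ := hδ
    exact ⟨τ, hτ⟩
  ext σ
  constructor
  -- If c were in S, write δ = μ ⊕ ν with ν in S. Then δ ⊕ c = μ ⊕ (ν ⊕ c) lies in `X` by
  -- sum-completeness, yet it is a basis element.
  · rintro hσ c ⟨hc0, hc, δ, hδ⟩ hcσ
    have hcS := hS σ hσ c hcσ
    have hδX : δ ∈ X := by
      by_contra hδX
      have := hδ.2 δ (involved_dsum_left δ c) hδX
      have : δ.1 = δ.1 + c.1 := congrArg Sigma.fst this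
      omega
    rw [h] at hδX
    obtain ⟨μ, hμ, ν, hν, rfl⟩ := hδX
    refine hδ.1 ?_
    rw [h]
    exact ⟨μ, hμ, dsum ν c, hS' ν hν c hcS, dsum_assoc _ _ _⟩
  · intro hσ
    have hγ : γ ∈ X := by
      obtain ⟨s, hs⟩ := hSne
      refine hX (dsum γ s) ?_ γ (involved_dsum_left γ s)
      rw [h]
      exact ⟨γ, Involved.refl γ, s, hs, rfl⟩
    -- Write γ ⊕ σ = μ ⊕ s. As μ is no longer than γ, the copy of σ lies entirely within s.
    have hd := dsum_mem_of_mem_av hX hγ hσ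
    rw [h] at hd
    obtain ⟨μ, hμ, s, hs, hd⟩ := hd
    refine hS s hs σ ?_
    have h1 : IsOcc σ (fun i => i) (dsum γ σ).2 (dsumInr γ σ) := dsum_isOcc_inr γ σ
    have hle : μ.1 ≤ γ.1 := Involved.le hμ
    have hval : ∀ i, γ.1 ≤ (dsumInr γ σ i).1 := fun i => by rw [dsumInr_val]; omega
    -- The positions are generalised because their type depends on the sum being rewritten.
    revert h1 hval
    generalize dsumInr γ σ = f
    revert f
    rw [hd]
    intro f h1 hval
    refine involved_of_isOcc h1 (dsum_isOcc_inr μ s) fun i => ?_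
    have := hval i
    revert this
    generalize f i = x
    revert x
    refine dsum_cases (fun i hi => ?_) (fun i _ => ⟨i, rfl⟩)
    rw [dsumInl_val] at hi
    exact absurd i.2 (by omega)

theorem finite_setOf_size_le (b : ℕ) : {α : FinPerm | α.1 ≤ b}.Finite := by
  refine (Set.finite_range (fun x : Σ n : Fin (b + 1), Equiv.Perm (Fin n) =>
    (⟨x.1.1, x.2⟩ : FinPerm))).subset ?_
  rintro ⟨n, σ⟩ hn
  exact ⟨⟨⟨n, Nat.lt_succ_of_le hn⟩, σ⟩, rfl⟩

theorem exists_size_bound {X : Set FinPerm} (hfb : IsFinitelyBased X) :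
    ∃ b, ∀ β ∈ basis X, β.1 ≤ b := by
  obtain ⟨b, hb⟩ := (hfb.image Sigma.fst).bddAbove
  exact ⟨b, fun β hβ => hb ⟨β, hβ, rfl⟩⟩

theorem size_le_of_mem_finalComponents {X : Set FinPerm} {b : ℕ} (hb : ∀ β ∈ basis X, β.1 ≤ b)
    {c : FinPerm} (hc : c ∈ finalComponents X) : c.1 ≤ b := by
  obtain ⟨_, _, δ, hδ⟩ := hc
  exact (involved_dsum_right δ c).le.trans (hb _ hδ)

/-- The patterns of a sequence of natural numbers, at positions in `E`. -/
abbrev SeqAge (a : ℕ → ℕ) (E : Set ℕ) : Set FinPerm := Age (fun i : ℕ => i) a E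

/-- The positions `≥ k` with values `≥ k`. -/
def tailSet (a : ℕ → ℕ) (k : ℕ) : Set ℕ := {i | k ≤ i ∧ k ≤ a i}

theorem tailSet_anti (a : ℕ → ℕ) {k l : ℕ} (h : k ≤ l) : tailSet a l ⊆ tailSet a k :=
  fun _ hi => ⟨h.trans hi.1, h.trans hi.2⟩

/-- Final components do not occur far out in `π`. -/
theorem exists_tail_subset_av {X : Set FinPerm} {π : Equiv.Perm ℕ} (hX : X = SubNat π)
    (hfb : IsFinitelyBased X) : ∃ k, SeqAge π (tailSet π k) ⊆ Av (finalComponents X) := by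
  have hcl : IsClosedClass X := hX ▸ isClosedClass_subNat π
  obtain ⟨b, hb⟩ := exists_size_bound hfb
  have hfin : (finalComponents X).Finite :=
    (finite_setOf_size_le b).subset fun c hc => size_le_of_mem_finalComponents hb hc
  have h1 : ∀ c ∈ finalComponents X, ∃ k, c ∉ SeqAge π (tailSet π k) := by
    rintro c ⟨hc0, hc, δ, hδ⟩
    have hδX : δ ∈ X := by
      by_contra hδX
      have := hδ.2 δ (involved_dsum_left δ c) hδX
      have : δ.1 = δ.1 + c.1 := congrArg Sigma.fst this
      omega
    rw [hX, subNat_eq_age] at hδX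
    obtain ⟨f, -, hf⟩ := hδX
    -- This threshold exceeds every position and value of a fixed occurrence of δ. An occurrence of
    -- c beyond it would complete an occurrence of δ ⊕ c.
    refine ⟨Finset.univ.sup f + Finset.univ.sup (fun i => π (f i)) + 1, ?_⟩
    rintro ⟨g, hgE, hg⟩
    refine hδ.1 ?_
    rw [hX, subNat_eq_age]
    refine dsum_mem_age hf hg (fun i j => ?_) (fun _ => trivial) (fun _ => trivial)
    have h1 := Finset.le_sup (f := f) (Finset.mem_univ i)
    have h2 := Finset.le_sup (f := fun i => π (f i)) (Finset.mem_univ i)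
    have h3 := hgE j
    simp only [tailSet, Set.mem_ofPred_eq] at h2 h3
    constructor <;> omega
  choose! k hk using h1
  obtain ⟨K, hK⟩ := (hfin.image k).bddAbove
  refine ⟨K, fun α hα c hc hcα => hk c hc ?_⟩
  exact age_subset (tailSet_anti _ (hK ⟨c, hc, rfl⟩)) (isClosedClass_age _ _ _ α hα c hcα)

/-- A finite set of points all of whose patterns occur in `(p', q')` maps into it. -/
theorem exists_map_of_age_subset [Nonempty κ] {p : ι → P} {q : ι → Q} {p' : κ → P'} {q' : κ → Q'}
    {E : Finset ι} {E' : Set κ} (hp : Set.InjOn p E) (hq : Set.InjOn q E)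
    (h : Age p q (E : Set ι) ⊆ Age p' q' E') :
    ∃ g : ι → κ, (∀ x ∈ E, g x ∈ E') ∧ (∀ x ∈ E, ∀ y ∈ E, p x < p y → p' (g x) < p' (g y)) ∧
      ∀ x ∈ E, ∀ y ∈ E, q x < q y → q' (g x) < q' (g y) := by
  classical
  obtain ⟨α, f, hf, hfE, hfs⟩ := exists_pattern p q E hp hq
  obtain ⟨f', hf'E, hf'⟩ := h ⟨f, hfE, hf⟩
  -- Points outside the range of `f` get an arbitrary image; every point of `E` is in the range.
  have hg : ∀ x, ∃ y, ∀ i, f i = x → y = f' i := fun x => by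
    by_cases hx : ∃ i, f i = x
    · obtain ⟨i, rfl⟩ := hx
      exact ⟨f' i, fun j hj => by rw [hf.injective hj]⟩
    · exact ⟨Classical.arbitrary κ, fun i hi => absurd ⟨i, hi⟩ hx⟩
  choose g hg using hg
  refine ⟨g, fun x hx => ?_, fun x hx y hy hxy => ?_, fun x hx y hy hxy => ?_⟩
  · obtain ⟨i, hi⟩ := hfs x hx
    rw [hg x i hi]; exact hf'E i
  all_goals
    obtain ⟨i, hi⟩ := hfs x hx
    obtain ⟨j, hj⟩ := hfs y hy
    rw [hg x i hi, hg y j hj]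
    rw [← hi, ← hj] at hxy
  · exact hf'.1 _ _ ((hf.pos_iff _ _).1 hxy)
  · exact hf'.2 _ _ ((hf.val_iff _ _).1 hxy)

end PermClass

/-! ### Limits of embeddings, and rigidity of classes that do not split -/

namespace PermClass

open Filter

/-- `X` is the sum of the patterns of a finite permutation and the class avoiding the final
components of its basis. -/
def Splits (X : Set FinPerm) : Prop := ∃ γ, X = dsumSet (Sub γ) (Av (finalComponents X))

/-- `f` embeds the points of `a` at positions in `E` into `b`. -/
def EmbedsOn (f : ℕ → ℕ) (a b : ℕ → ℕ) (E : Set ℕ) : Prop :=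
  (∀ i ∈ E, ∀ j ∈ E, i < j → f i < f j) ∧ ∀ i ∈ E, ∀ j ∈ E, a i < a j → b (f i) < b (f j)

theorem EmbedsOn.mono {f a b : ℕ → ℕ} {E E' : Set ℕ} (h : EmbedsOn f a b E) (hE : E' ⊆ E) :
    EmbedsOn f a b E' :=
  ⟨fun i hi j hj => h.1 i (hE hi) j (hE hj), fun i hi j hj => h.2 i (hE hi) j (hE hj)⟩

theorem EmbedsOn.comp {f g a b c : ℕ → ℕ} (h : EmbedsOn f a b Set.univ)
    (h' : EmbedsOn g b c Set.univ) : EmbedsOn (fun i => g (f i)) a c Set.univ :=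
  ⟨fun _ _ _ _ hij => h'.1 _ trivial _ trivial (h.1 _ trivial _ trivial hij),
    fun _ _ _ _ hij => h'.2 _ trivial _ trivial (h.2 _ trivial _ trivial hij)⟩

theorem EmbedsOn.seqAge_subset {f a b : ℕ → ℕ} {E E' : Set ℕ} (h : EmbedsOn f a b E)
    (hE : ∀ i ∈ E, f i ∈ E') : SeqAge a E ⊆ SeqAge b E' :=
  age_mono f hE h.1 h.2

theorem exists_tail_bound (π : Equiv.Perm ℕ) (k : ℕ) : ∃ K, k ≤ K ∧ ∀ i, K ≤ i → k ≤ π i := by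
  obtain ⟨K, hK⟩ := ((Set.finite_Iio k).image π.symm).bddAbove
  refine ⟨max k (K + 1), le_max_left _ _, fun i hi => ?_⟩
  by_contra! hlt
  have := hK ⟨π i, hlt, π.symm_apply_apply i⟩
  have := le_max_right k (K + 1)
  omega

/-- Embeddings of longer and longer prefixes of `ρ` into `π` either have a limit, or `ρ` has a cut
past which the embeddings escape to infinity. -/
theorem exists_limit {ρ : ℕ → ℕ} (hρ : Function.Injective ρ) {π : Equiv.Perm ℕ} (F : ℕ → ℕ → ℕ)
    (hF : ∀ n, EmbedsOn (F n) ρ π (Set.Iio n)) :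
    (∃ f, EmbedsOn f ρ π Set.univ ∧ ∀ r N, ∃ n ≥ N, ∀ j < r, F n j = f j) ∨
    ∃ w, (∀ i j, i < w → w ≤ j → ρ i < ρ j) ∧
      ∀ k m, ∃ n ≥ m, ∀ j, w ≤ j → j < n → F n j ∈ tailSet π k := by
  classical
  -- For an ultrafilter, the images of a point either are eventually constant or eventually avoid
  -- each given value, so no successive subsequences are needed.
  let U : Ultrafilter ℕ := hyperfilter ℕ
  have hge : ∀ m, ∀ᶠ n in (U : Filter ℕ), m ≤ n := fun m =>
    (Nat.hyperfilter_le_atTop) (eventually_ge_atTop m)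
  by_cases hP : ∀ j, ∃ m, ∀ᶠ n in (U : Filter ℕ), F n j = m
  · left
    choose f hf using hP
    refine ⟨f, ⟨fun i _ j _ hij => ?_, fun i _ j _ hij => ?_⟩, fun r N => ?_⟩
    · obtain ⟨n, h1, h2, h3⟩ := ((hf i).and ((hf j).and (hge (max i j + 1)))).exists
      rw [← h1, ← h2]
      exact (hF n).1 i (by simp only [Set.mem_Iio]; omega) j (by simp only [Set.mem_Iio]; omega) hij
    · obtain ⟨n, h1, h2, h3⟩ := ((hf i).and ((hf j).and (hge (max i j + 1)))).exists
      rw [← h1, ← h2]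
      exact (hF n).2 i (by simp only [Set.mem_Iio]; omega) j (by simp only [Set.mem_Iio]; omega) hij
    · have h1 : ∀ᶠ n in (U : Filter ℕ), ∀ j ∈ Set.Iio r, F n j = f j :=
        (eventually_all_finite (Set.finite_Iio r)).2 fun j _ => hf j
      obtain ⟨n, h1, h2⟩ := (h1.and (hge N)).exists
      exact ⟨n, h2, h1⟩
  · right
    push Not at hP
    -- The cut w is the least index whose images do not stabilise. Its images leave every finite
    -- set, and by monotonicity so do those of all later indices.
    have hw := Nat.find_spec hP
    have hlt : ∀ i < Nat.find hP, ∃ m, ∀ᶠ n in (U : Filter ℕ), F n i = m := fun i hi => by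
      have := Nat.find_min hP hi
      push Not at this
      exact this
    revert hw hlt
    generalize Nat.find hP = w
    intro hw hlt
    have hesc : ∀ k m, ∀ᶠ n in (U : Filter ℕ), m ≤ n ∧
        ∀ j, w ≤ j → j < n → F n j ∈ tailSet π k := by
      intro k m
      obtain ⟨K, hK, hKπ⟩ := exists_tail_bound π k
      have h1 : ∀ᶠ n in (U : Filter ℕ), ∀ x ∈ Set.Iio K, F n w ≠ x :=
        (eventually_all_finite (Set.finite_Iio K)).2 fun x _ => hw x
      filter_upwards [h1, hge m] with n h1 h2
      refine ⟨h2, fun j hj hjn => ?_⟩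
      have h3 : K ≤ F n w := by
        by_contra! h
        exact h1 _ h rfl
      have h4 : K ≤ F n j := by
        rcases hj.eq_or_lt with rfl | hj
        · exact h3
        · exact h3.trans ((hF n).1 w (hj.trans hjn) j hjn hj).le
      exact ⟨hK.trans h4, hKπ _ h4⟩
    refine ⟨w, fun i j hi hj => ?_, fun k m => (hesc k m).exists⟩
    obtain ⟨m, hm⟩ := hlt i hi
    -- The image of i is frozen at m, while for suitable n the image of j has value above π m. Hence
    -- i and j are not inverted.
    obtain ⟨n, h1, h2, h3⟩ := (hm.and (hesc (π m + 1) (j + 1))).exists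
    by_contra hcon
    have hne : ρ j < ρ i := lt_of_le_of_ne (not_lt.1 hcon) fun he => by
      have := hρ he
      omega
    have h4 := (hF n).2 j (by simp only [Set.mem_Iio]; omega) i (by simp only [Set.mem_Iio]; omega) hne
    have h5 := (h3 j hj (by omega)).2
    rw [h1] at h4
    omega

/-- A sequence with a cut, past which the final components do not occur, generates a class that
splits. -/
theorem splits_of_cut {X : Set FinPerm} (hcl : IsClosedClass X) {ρ : ℕ → ℕ}
    (hρ : Function.Injective ρ) (hX : X = SeqAge ρ Set.univ) {w : ℕ}
    (hw : ∀ i j, i < w → w ≤ j → ρ i < ρ j)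
    (hS : SeqAge ρ (Set.Ici w) ⊆ Av (finalComponents X)) : Splits X := by
  obtain ⟨γ, g, hg, hgw, hgs⟩ := exists_pattern (fun i : ℕ => i) ρ (Finset.range w)
    (fun _ _ _ _ h => h) hρ.injOn
  have hγ : γ ∈ X := by rw [hX]; exact ⟨g, fun _ => trivial, hg⟩
  refine ⟨γ, Set.Subset.antisymm (fun α hα => ?_) ?_⟩
  · rw [hX] at hα
    obtain ⟨f, -, hf⟩ := hα
    -- v is the number of entries of α placed before w.
    let v := (Finset.univ.filter fun i => f i < w).sup fun i : Fin α.1 => i.1 + 1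
    have hv : ∀ i, i.1 < v ↔ f i < w := by
      intro i
      simp only [v, Finset.lt_sup_iff, Finset.mem_filter, Finset.mem_univ, true_and]
      constructor
      · rintro ⟨j, hj, hij⟩
        rcases (Nat.lt_succ_iff.1 hij).eq_or_lt with h | h
        · rwa [Fin.ext h]
        · exact (hf.1 i j h).trans hj
      · intro h
        exact ⟨i, h, Nat.lt_succ_self _⟩
    have hvα : v ≤ α.1 := Finset.sup_le fun i _ => i.2
    obtain ⟨σ, τ, rfl, hσ⟩ := exists_eq_dsum α v hvα fun i j hi hj => by
      rw [← hf.val_iff]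
      exact hw _ _ ((hv i).1 hi) (not_lt.1 fun h => absurd ((hv j).2 h) (by omega))
    obtain ⟨h1, h2, -⟩ := isOcc_dsum.1 hf
    refine ⟨σ, involved_of_isOcc h1 hg fun i => ?_, τ, hS ⟨_, fun i => ?_, h2⟩, rfl⟩
    · refine hgs _ (Finset.mem_range.2 ((hv _).1 ?_))
      rw [dsumInl_val]
      exact lt_of_lt_of_eq i.2 hσ
    · refine Set.mem_Ici.2 (not_lt.1 fun h => ?_)
      have := (hv _).2 h
      rw [dsumInr_val] at this
      omega
  · rintro α ⟨σ, hσ, τ, hτ, rfl⟩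
    exact dsum_mem_of_mem_av hcl (hcl γ hγ σ hσ) hτ

/-! ### Rigidity of π when X does not split -/

section rigid

variable {X : Set FinPerm} {π : Equiv.Perm ℕ} (hX : X = SubNat π) (hfb : IsFinitelyBased X)
  (hns : ¬ Splits X)

include hX hfb hns

/-- In the escaping case every pattern past the cut also occurs far out in π, hence avoids the final
components, and `X` would split. -/
theorem exists_limit_of_not_splits {ρ : ℕ → ℕ} (hρ : Function.Injective ρ)
    (hXρ : X = SeqAge ρ Set.univ) (F : ℕ → ℕ → ℕ) (hF : ∀ n, EmbedsOn (F n) ρ π (Set.Iio n)) :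
    ∃ f, EmbedsOn f ρ π Set.univ ∧ ∀ r N, ∃ n ≥ N, ∀ j < r, F n j = f j := by
  refine (exists_limit hρ F hF).resolve_right ?_
  rintro ⟨w, hw, hesc⟩
  refine hns (splits_of_cut (hX ▸ isClosedClass_subNat π) hρ hXρ hw ?_)
  obtain ⟨k, hk⟩ := exists_tail_subset_av hX hfb
  rintro α ⟨f, hfw, hf⟩
  obtain ⟨n, hn, h⟩ := hesc k (Finset.univ.sup f + 1)
  have hlt : ∀ i, f i < n := fun i => by
    have := Finset.le_sup (f := f) (Finset.mem_univ i)
    omega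
  exact hk ⟨fun i => F n (f i), fun i => h _ (hfw i) (hlt i),
    hf.comp (E := Set.Iio n) hlt (hF n).1 (hF n).2⟩

/-- The iterates of a self-embedding that moves i push i to infinity, whereas they must have a limit
embedding along infinitely many exponents. -/
theorem embedding_eq_self {f : ℕ → ℕ} (hf : EmbedsOn f π π Set.univ) (i : ℕ) : f i = i := by
  have hmono : StrictMono f := fun i j hij => hf.1 i trivial j trivial hij
  have hit : ∀ n, EmbedsOn (f^[n]) π π Set.univ := fun n => by
    induction n with
    | zero => exact ⟨fun _ _ _ _ h => h, fun _ _ _ _ h => h⟩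
    | succ n ih => rw [Function.iterate_succ]; exact hf.comp ih
  by_contra hne
  have hlt : i < f i := lt_of_le_of_ne (hmono.le_apply) (Ne.symm hne)
  have hgrow : ∀ n, n ≤ f^[n] i := fun n => by
    have : ∀ n, f^[n] i < f^[n + 1] i := fun n => by
      rw [Function.iterate_succ_apply]
      exact hmono.iterate n hlt
    exact (strictMono_nat_of_lt_succ this).le_apply
  obtain ⟨g, -, hg⟩ := exists_limit_of_not_splits hX hfb hns π.injective (hX.trans (subNat_eq_age π))
    (fun n => f^[n]) (fun n => (hit n).mono (Set.subset_univ _))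
  -- Some exponent n greater than g i sends i to g i, although the n-th iterate sends i to at least
  -- n.
  obtain ⟨n, hn, h⟩ := hg (i + 1) (g i + 1)
  have h1 := h i (Nat.lt_succ_self i)
  have h2 := hgrow n
  omega

omit hfb hns in
theorem exists_prefix_embeddings {ρ : ℕ → ℕ} (hρ : Function.Injective ρ) {E : Set ℕ}
    (hXρ : SeqAge ρ E ⊆ X) (hE : ∀ n, Set.Iio n ⊆ E) :
    ∃ F : ℕ → ℕ → ℕ, ∀ n, EmbedsOn (F n) ρ π (Set.Iio n) := by
  have : ∀ n, ∃ f, EmbedsOn f ρ π (Set.Iio n) := fun n => by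
    obtain ⟨g, -, h1, h2⟩ := exists_map_of_age_subset (p := fun i : ℕ => i) (q := ρ)
      (p' := fun i : ℕ => i) (q' := π) (E := Finset.range n) (E' := Set.univ)
      (fun _ _ _ _ h => h) hρ.injOn (by
        rw [← subNat_eq_age, ← hX]
        exact (age_subset (by rw [Finset.coe_range]; exact hE n)).trans hXρ)
    exact ⟨g, fun i hi j hj => h1 i (Finset.mem_range.2 hi) j (Finset.mem_range.2 hj),
      fun i hi j hj => h2 i (Finset.mem_range.2 hi) j (Finset.mem_range.2 hj)⟩
  choose F hF using this
  exact ⟨F, hF⟩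

theorem exists_embedding {ρ : ℕ → ℕ} (hρ : Function.Injective ρ) (hXρ : X = SeqAge ρ Set.univ) :
    ∃ f, EmbedsOn f ρ π Set.univ := by
  obtain ⟨F, hF⟩ := exists_prefix_embeddings hX hρ hXρ.ge (fun _ => Set.subset_univ _)
  obtain ⟨f, hf, -⟩ := exists_limit_of_not_splits hX hfb hns hρ hXρ F hF
  exact ⟨f, hf⟩

/-- `π` cannot be extended within `X`. -/
theorem surjective_of_embedding {ρ : ℕ → ℕ} (hρ : Function.Injective ρ)
    (hXρ : SeqAge ρ Set.univ ⊆ X) {g : ℕ → ℕ} (hg : EmbedsOn g π ρ Set.univ) :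
    Function.Surjective g := by
  obtain ⟨f, hf⟩ := exists_embedding hX hfb hns hρ (Set.Subset.antisymm
    (by rw [hX, subNat_eq_age]; exact hg.seqAge_subset fun _ _ => trivial) hXρ)
  have hmono : StrictMono f := fun i j hij => hf.1 i trivial j trivial hij
  intro j
  -- The composite f ∘ g is the identity, so f (g (f j)) = f j, and f is injective.
  exact ⟨f j, hmono.injective (embedding_eq_self hX hfb hns (hg.comp hf) (f j))⟩

omit hX hfb hns in
theorem eq_id_of_strictMono_of_surjective {f : ℕ → ℕ} (hf : StrictMono f)
    (hs : Function.Surjective f) (i : ℕ) : f i = i := by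
  have h : hf.orderIsoOfSurjective f hs = OrderIso.refl ℕ := Subsingleton.elim _ _
  exact congrArg (fun e : ℕ ≃o ℕ => e i) h

omit hX hfb hns in
/-- Two permutations of `ℕ` in the same relative order are equal. -/
theorem perm_eq_of_order {a : ℕ → ℕ} (ha : Function.Surjective a)
    (h : ∀ i j, π i < π j → a i < a j) (i : ℕ) : a i = π i := by
  have := eq_id_of_strictMono_of_surjective (f := fun y => a (π.symm y))
    (fun x y hxy => h _ _ (by simpa using hxy)) (ha.comp π.symm.surjective) (π i)
  simpa using this

/-- An embedding of π into π' is onto, since π has no proper extension within `X`. Being increasing,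
it is the identity on positions. -/
theorem eq_of_subNat_eq {π' : Equiv.Perm ℕ} (hX' : X = SubNat π') : π' = π := by
  obtain ⟨g, hg⟩ := exists_embedding hX' hfb hns π.injective (hX.trans (subNat_eq_age π))
  have hs := surjective_of_embedding hX hfb hns π'.injective
    (hX'.trans (subNat_eq_age π')).ge hg
  have hid := eq_id_of_strictMono_of_surjective
    (fun i j hij => hg.1 i trivial j trivial hij) hs
  ext i
  refine perm_eq_of_order π'.surjective (fun i j hij => ?_) i
  have := hg.2 i trivial j trivial hij
  rwa [hid, hid] at this

/-- Embeddings of long prefixes of `π` into `π` fix short prefixes. -/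
theorem exists_prefix_rigid (r : ℕ) :
    ∃ u, ∀ f, EmbedsOn f π π (Set.Iio u) → ∀ j < r, f j = j := by
  by_contra! h
  choose F hF j hj hne using h
  obtain ⟨g, hg, hlim⟩ := exists_limit_of_not_splits hX hfb hns π.injective
    (hX.trans (subNat_eq_age π)) F hF
  obtain ⟨n, -, hn⟩ := hlim r 0
  refine hne n ?_
  rw [hn _ (hj n), embedding_eq_self hX hfb hns hg]

/-- Only finitely many prefixes of `π` are mapped to themselves. -/
theorem exists_no_cut : ∃ u, ∀ w, u ≤ w → ∃ i j, i < w ∧ w ≤ j ∧ π j < π i := by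
  by_contra! h
  obtain ⟨k, hk⟩ := exists_tail_subset_av hX hfb
  obtain ⟨K, hK, hKπ⟩ := exists_tail_bound π k
  obtain ⟨w, hw, hcut⟩ := h K
  refine hns (splits_of_cut (hX ▸ isClosedClass_subNat π) π.injective
    (hX.trans (subNat_eq_age π)) (w := w) (fun i j hi hj => ?_) ?_)
  · exact lt_of_le_of_ne (hcut i j hi hj) fun he => by
      have := π.injective he
      omega
  · refine (age_subset fun i hi => ?_).trans hk
    have hi : w ≤ i := hi
    exact ⟨by omega, hKπ i (by omega)⟩

end rigid

end PermClass

/-! ### Distances and geodesics in the inversion graph -/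

namespace PermClass

/-- The positions `i` and `j` form an inversion of `a`. -/
def Inv (a : ℕ → ℕ) (i j : ℕ) : Prop := (i < j ∧ a j < a i) ∨ (j < i ∧ a i < a j)

theorem Inv.symm {a : ℕ → ℕ} {i j : ℕ} (h : Inv a i j) : Inv a j i := Or.symm h

theorem finite_inv (π : Equiv.Perm ℕ) (i : ℕ) : {j | Inv π i j}.Finite := by
  refine ((Set.finite_Iio i).union ((Set.finite_Iio (π i)).preimage π.injective.injOn)).subset ?_
  rintro j (h | h)
  · exact Or.inr h.2
  · exact Or.inl h.1

/-- Along an indecomposable permutation, a quantity changing by at most one across inversions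
varies by less than the size. -/
theorem IsIndecomposable.lt_add_size {c : FinPerm} (hc : IsIndecomposable c) (lev : Fin c.1 → ℕ)
    (h : ∀ i j, i < j → c.2 j < c.2 i → lev i ≤ lev j + 1 ∧ lev j ≤ lev i + 1) (i j : Fin c.1) :
    lev i < lev j + c.1 := by
  by_contra! hcon
  -- Every intermediate level is attained: some inversion crosses the threshold t, and its ends
  -- differ by at most one level. The number of levels attained is at most the size of `c`.
  have hsub : Finset.Icc (lev j) (lev i) ⊆ Finset.univ.image lev := by
    intro t ht
    rw [Finset.mem_Icc] at ht
    rcases ht.2.eq_or_lt with rfl | hlt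
    · exact Finset.mem_image_of_mem _ (Finset.mem_univ _)
    · obtain ⟨x, y, hxy, hyx, hA⟩ := hc.exists_crossing (fun m => lev m ≤ t) (a := j) (b := i) ht.1
        (not_le.2 hlt)
      have := h x y hxy hyx
      rw [Finset.mem_image]
      by_cases hx : lev x ≤ t
      · exact ⟨x, Finset.mem_univ _, by have : ¬ lev y ≤ t := by tauto
                                        omega⟩
      · exact ⟨y, Finset.mem_univ _, by have : lev y ≤ t := by tauto
                                        omega⟩
  have h1 := Finset.card_le_card hsub
  have h2 : (Finset.univ.image lev).card ≤ c.1 := Finset.card_image_le.trans (by simp)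
  rw [Nat.card_Icc] at h1
  have := j.2
  omega

/-- The points at distance at most `t` from `[0, y]` in the inversion graph. -/
def ball (a : ℕ → ℕ) (y : ℕ) : ℕ → Set ℕ
  | 0 => Set.Iic y
  | t + 1 => ball a y t ∪ {v | ∃ u ∈ ball a y t, Inv a u v}

theorem finite_ball (π : Equiv.Perm ℕ) (y t : ℕ) : (ball π y t).Finite := by
  induction t with
  | zero => exact Set.finite_Iic y
  | succ t ih =>
    refine ih.union ((ih.biUnion fun u _ => finite_inv π u).subset ?_)
    rintro v ⟨u, hu, huv⟩
    exact Set.mem_biUnion hu huv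

/-- The absence of cuts from y on makes every point reachable from [0, y]. At the least unreached
point m, an inversion crosses the cut at m and starts at a reached point, which leads to a
contradiction. -/
theorem ball_covers {π : Equiv.Perm ℕ} {y : ℕ}
    (h : ∀ w, y ≤ w → ∃ i j, i < w ∧ w ≤ j ∧ π j < π i) (v : ℕ) : ∃ t, v ∈ ball π y t := by
  classical
  by_contra hv
  have hex : ∃ v, ¬ ∃ t, v ∈ ball π y t := ⟨v, hv⟩
  have hm := Nat.find_spec hex
  have hlt : ∀ a < Nat.find hex, ∃ t, a ∈ ball π y t := fun a ha => not_not.1 (Nat.find_min hex ha)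
  revert hm hlt
  generalize Nat.find hex = m
  intro hm hlt
  have hinv : ∀ u t, u ∈ ball π y t → ∀ v, (¬ ∃ t, v ∈ ball π y t) → ¬ Inv π u v :=
    fun u t hu v hv huv => hv ⟨t + 1, Or.inr ⟨u, hu, huv⟩⟩
  have hym : y < m := by
    by_contra hle
    exact hm ⟨0, not_lt.1 hle⟩
  obtain ⟨i, j, hi, hj, hji⟩ := h m hym.le
  obtain ⟨t, ht⟩ := hlt i hi
  by_cases hjK : ∃ t, j ∈ ball π y t
  · obtain ⟨t', ht'⟩ := hjK
    have h1 : m < j := lt_of_le_of_ne hj fun he => hm ⟨t', he ▸ ht'⟩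
    -- The ends i < m < j are reached and inverted, so m must be inverted with one of them.
    have h2 := hinv i t ht m hm
    have h3 := hinv j t' ht' m hm
    simp only [Inv, not_or, not_and, not_lt] at h2 h3
    have := h2.1 hi
    have := h3.2 h1
    omega
  · exact hinv i t ht j hjK (Or.inl ⟨by omega, hji⟩)

/-- The distance from the initial points of a sequence in its inversion graph. -/
theorem exists_level {π : Equiv.Perm ℕ} {y : ℕ}
    (h : ∀ w, y ≤ w → ∃ i j, i < w ∧ w ≤ j ∧ π j < π i) :
    ∃ lev : ℕ → ℕ, (∀ i j, Inv π i j → lev j ≤ lev i + 1) ∧ (∀ t, {v | lev v ≤ t}.Finite) ∧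
      ∀ s l, lev l = s → ∃ z : ℕ → ℕ, z 0 ≤ y ∧ z s = l ∧ (∀ j ≤ s, lev (z j) = j) ∧
        ∀ j < s, Inv π (z j) (z (j + 1)) := by
  classical
  have hc := ball_covers h
  have hmono : ∀ t t', t ≤ t' → ball π y t ⊆ ball π y t' := fun t t' htt' => by
    induction htt' with
    | refl => exact subset_rfl
    | step _ ih => exact ih.trans Set.subset_union_left
  have hlev : ∀ v t, Nat.find (hc v) ≤ t ↔ v ∈ ball π y t := fun v t =>
    ⟨fun hle => hmono _ _ hle (Nat.find_spec (hc v)), fun hv => Nat.find_min' (hc v) hv⟩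
  have hinv : ∀ i j, Inv π i j → Nat.find (hc j) ≤ Nat.find (hc i) + 1 := fun i j hij =>
    (hlev j _).2 (Or.inr ⟨i, Nat.find_spec (hc i), hij⟩)
  refine ⟨fun v => Nat.find (hc v), hinv, fun t => ?_, fun s => ?_⟩
  · exact (finite_ball π y t).subset fun v hv => (hlev v t).1 hv
  · induction s with
    | zero =>
      intro l hl
      refine ⟨fun _ => l, (hlev l 0).1 hl.le, rfl, fun j hj => ?_, fun j hj => absurd hj (by omega)⟩
      rw [hl]; omega
    | succ s ih =>
      intro l hl
      have h1 : l ∈ ball π y (s + 1) := (hlev l _).1 hl.le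
      have h2 : l ∉ ball π y s := fun h2 => by
        have := (hlev l s).2 h2
        simp only at hl
        omega
      obtain ⟨u, hu, hul⟩ := h1.resolve_left h2
      have hus : Nat.find (hc u) = s := by
        refine le_antisymm ((hlev u s).2 hu) ?_
        have := hinv u l hul
        simp only at hl
        omega
      obtain ⟨z, hz0, hzs, hzl, hz⟩ := ih u hus
      -- The path is prolonged by l; its values after s + 1 are irrelevant.
      refine ⟨fun j => if j ≤ s then z j else l, by simpa using hz0, by simp, fun j hj => ?_,
        fun j hj => ?_⟩
      · by_cases hjs : j ≤ s
        · simp only [hjs, if_true]; exact hzl j hjs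
        · obtain rfl : j = s + 1 := by omega
          simpa using hl
      · by_cases hjs : j + 1 ≤ s
        · simp only [hjs, (show j ≤ s by omega), if_true]; exact hz j (by omega)
        · obtain rfl : j = s := by omega
          simpa [hzs] using hul

/-- The relative order of the points `x` and `y`. -/
def orderBits (a : ℕ → ℕ) (x y : ℕ) : Bool × Bool := (decide (x < y), decide (a x < a y))

theorem orderBits_fst {a : ℕ → ℕ} {x y x' y' : ℕ} (h : orderBits a x y = orderBits a x' y') :
    x < y ↔ x' < y' := by
  have := congrArg Prod.fst h
  simpa [orderBits] using this

theorem orderBits_snd {a : ℕ → ℕ} {x y x' y' : ℕ} (h : orderBits a x y = orderBits a x' y') :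
    a x < a y ↔ a x' < a y' := by
  have := congrArg Prod.snd h
  simpa [orderBits] using this

/-- A geodesic `z` of length `s`, at least `L`, together with `n` points of inversion with its
endpoint, such that the last `m` points of the geodesic and these points are related as
prescribed by `T`. -/
structure Fan (a lev : ℕ → ℕ) (y L m : ℕ)
    (T : (Fin m → Fin m → Bool × Bool) × (Fin m → Bool × Bool)) (n : ℕ) where
  s : ℕ
  z : ℕ → ℕ
  R : Finset ℕ
  le_s : L ≤ s
  z_zero : z 0 ≤ y
  lev_z : ∀ j ≤ s, lev (z j) = j
  inv_z : ∀ j < s, Inv a (z j) (z (j + 1))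
  card_R : n ≤ R.card
  inv_R : ∀ r ∈ R, Inv a (z s) r
  ne_R : ∀ r ∈ R, ∀ j ≤ s, r ≠ z j
  bits_z : ∀ i j, T.1 i j = orderBits a (z (s - i)) (z (s - j))
  bits_R : ∀ r ∈ R, ∀ i, T.2 i = orderBits a (z (s - i)) r

/-- Points of bounded level are finite in number, each with finitely many inversions, so very large
degrees occur only at high levels. There are finitely many types, so one of them admits arbitrarily
large fans. -/
theorem exists_fan {π : Equiv.Perm ℕ} {lev : ℕ → ℕ} {y : ℕ}
    (hlev : ∀ i j, Inv π i j → lev j ≤ lev i + 1) (hfin : ∀ t, {v | lev v ≤ t}.Finite)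
    (hpath : ∀ s l, lev l = s → ∃ z : ℕ → ℕ, z 0 ≤ y ∧ z s = l ∧ (∀ j ≤ s, lev (z j) = j) ∧
        ∀ j < s, Inv π (z j) (z (j + 1)))
    (hdeg : ∀ M, ∃ i, ∃ F : Finset ℕ, (∀ j ∈ F, Inv π i j) ∧ M < F.card) (L m : ℕ) :
    ∃ T, ∀ n, Nonempty (Fan π lev y L m T n) := by
  classical
  have key : ∀ n, ∃ T, Nonempty (Fan π lev y L m T n) := by
    intro n
    let B := (hfin L).toFinset.sup fun i => (finite_inv π i).toFinset.card
    -- B excludes low levels. The product makes the pigeonhole leave n points in one class, and the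
    -- extra 1 pays for removing the predecessor of l on the geodesic.
    obtain ⟨l, F, hF, hcard⟩ := hdeg (B + (Fintype.card (Fin m → Bool × Bool) * n + 1))
    have hl : L ≤ lev l := by
      by_contra! hlt
      have h1 : (finite_inv π l).toFinset.card ≤ B :=
        Finset.le_sup (f := fun i => (finite_inv π i).toFinset.card) (by simpa using hlt.le)
      have h2 : F.card ≤ (finite_inv π l).toFinset.card :=
        Finset.card_le_card fun j hj => by simpa using hF j hj
      omega
    obtain ⟨z, hz0, hzs, hzl, hz⟩ := hpath _ l rfl
    have hF' : Fintype.card (Fin m → Bool × Bool) * n ≤ (F.erase (z (lev l - 1))).card := by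
      have := Finset.pred_card_le_card_erase (s := F) (a := z (lev l - 1))
      omega
    obtain ⟨T2, -, hT2⟩ := Finset.exists_le_card_fiber_of_mul_le_card_of_maps_to
      (f := fun r => fun i : Fin m => orderBits π (z (lev l - i)) r)
      (fun r _ => Finset.mem_univ _) Finset.univ_nonempty hF'
    refine ⟨(fun i j => orderBits π (z (lev l - i)) (z (lev l - j)), T2),
      ⟨lev l, z, _, hl, hz0, hzl, hz, hT2, fun r hr => ?_, fun r hr j hj => ?_, fun _ _ => rfl,
        fun r hr i => ?_⟩⟩
    · rw [hzs]
      exact hF r (Finset.mem_of_mem_erase (Finset.mem_filter.1 hr).1)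
    · rintro rfl
      have h1 := (Finset.mem_filter.1 hr).1
      rw [Finset.mem_erase] at h1
      have h2 := hF _ h1.2
      -- A fan point on the geodesic has level at least s - 1. It is thus either the endpoint, which
      -- is not inverted with itself, or the erased predecessor.
      have h3 := hlev _ _ h2.symm
      have h4 := hzl j hj
      rcases hj.eq_or_lt with rfl | hj
      · rw [hzs] at h2
        simp [Inv] at h2
      · exact h1.1 (congrArg z (by omega))
    · exact (congrFun (Finset.mem_filter.1 hr).2 i).symm
  -- The type found may depend on n. If each type failed for some n, the maximum of these n would
  -- contradict `key`, because a large fan serves for smaller n too.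
  by_contra! hcon
  choose n hn using hcon
  obtain ⟨T, ⟨D⟩⟩ := key (Finset.univ.sup n)
  have h1 : n T ≤ Finset.univ.sup n := Finset.le_sup (Finset.mem_univ T)
  exact (not_nonempty_iff.2 (hn T)) ⟨{ D with card_R := h1.trans D.card_R }⟩

end PermClass

/-! ### Exchanging fans: bounded degrees in the inversion graph -/

namespace PermClass

/-- Positions of the configuration obtained from a sequence by replacing the point at `r₀` by a
block of points. -/
def blockPos (r₀ : ℕ) : ℕ ⊕ ℕ → ℕ ×ₗ ℕ :=
  Sum.elim (fun e => toLex (e, 0)) (fun r => toLex (r₀, r))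

/-- Values of the configuration obtained from `a` by replacing the point at `r₀` by a block of
points. -/
def blockVal (a : ℕ → ℕ) (r₀ : ℕ) : ℕ ⊕ ℕ → ℕ ×ₗ ℕ :=
  Sum.elim (fun e => toLex (a e, 0)) (fun r => toLex (a r₀, a r))

theorem subNat_nonempty (π : Equiv.Perm ℕ) : (SubNat π).Nonempty := by
  rw [subNat_eq_age]
  exact ⟨⟨0, 1⟩, fun i => i.elim0, fun i => i.elim0, fun i => i.elim0, fun i => i.elim0⟩

section block

variable {π : Equiv.Perm ℕ} {lev : ℕ → ℕ} {y L m n : ℕ}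
  {T : (Fin m → Fin m → Bool × Bool) × (Fin m → Bool × Bool)}

/-- The part of the block configuration near the end of a geodesic embeds near the end of any
geodesic of the same type. -/
theorem Fan.block_age_subset (D₀ : Fan π lev y L m T 1) {r₀ : ℕ} (hr₀ : r₀ ∈ D₀.R)
    (D : Fan π lev y L m T n) :
    Age (blockPos r₀) (blockVal π r₀)
      ({x | (∃ i : Fin m, i.1 ≤ D₀.s ∧ x = Sum.inl (D₀.z (D₀.s - i))) ∨ ∃ r ∈ D.R, x = Sum.inr r}) ⊆
      SeqAge π ({v | (∃ i : Fin m, v = D.z (D.s - i)) ∨ v ∈ D.R}) := by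
  have hlev : ∀ i ≤ D₀.s, D₀.s - lev (D₀.z (D₀.s - i)) = i := fun i hi => by
    rw [D₀.lev_z _ (by omega)]; omega
  have hπ : ∀ r ∈ D.R, ∀ j ≤ D.s, π r ≠ π (D.z j) := fun r hr j hj h =>
    D.ne_R r hr j hj (π.injective h)
  have hπ₀ : ∀ j ≤ D₀.s, π r₀ ≠ π (D₀.z j) := fun j hj h => D₀.ne_R r₀ hr₀ j hj (π.injective h)
  -- A geodesic point is recovered from its level, and is sent to the point at the same distance
  -- from the end of the other geodesic.
  refine age_mono (Sum.elim (fun e => D.z (D.s - (D₀.s - lev e))) id) ?_ ?_ ?_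
  · rintro x (⟨i, hi, rfl⟩ | ⟨r, hr, rfl⟩)
    · exact Or.inl ⟨i, by simp [hlev i hi]⟩
    · exact Or.inr hr
  · rintro x (⟨i, hi, rfl⟩ | ⟨r, hr, rfl⟩) x' (⟨j, hj, rfl⟩ | ⟨r', hr', rfl⟩) hlt
    · have hb := orderBits_fst ((D₀.bits_z i j).symm.trans (D.bits_z i j))
      simp only [blockPos, Sum.elim_inl, Prod.Lex.toLex_lt_toLex, lt_irrefl, and_false,
        or_false] at hlt
      simp only [Sum.elim_inl, hlev i hi, hlev j hj]
      exact hb.1 hlt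
    · have hb := orderBits_fst ((D₀.bits_R r₀ hr₀ i).symm.trans (D.bits_R r' hr' i))
      have hne := D₀.ne_R r₀ hr₀ (D₀.s - i) (by omega)
      -- A geodesic point differs from r₀, so it compares with the whole block as it does with r₀.
      -- Equality of types transfers this to the points of `D.R`.
      simp only [blockPos, Sum.elim_inl, Sum.elim_inr, Prod.Lex.toLex_lt_toLex] at hlt
      simp only [Sum.elim_inl, Sum.elim_inr, hlev i hi, id]
      exact hb.1 (by omega)
    · have hb := orderBits_fst ((D₀.bits_R r₀ hr₀ j).symm.trans (D.bits_R r hr j))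
      have hne := D.ne_R r hr (D.s - j) (by omega)
      simp only [blockPos, Sum.elim_inl, Sum.elim_inr, Prod.Lex.toLex_lt_toLex] at hlt
      simp only [Sum.elim_inl, Sum.elim_inr, hlev j hj, id]
      have := hb.not.1 (by omega)
      omega
    · simp only [blockPos, Sum.elim_inr, Prod.Lex.toLex_lt_toLex, lt_irrefl, false_or,
        true_and] at hlt
      exact hlt
  · rintro x (⟨i, hi, rfl⟩ | ⟨r, hr, rfl⟩) x' (⟨j, hj, rfl⟩ | ⟨r', hr', rfl⟩) hlt
    · have hb := orderBits_snd ((D₀.bits_z i j).symm.trans (D.bits_z i j))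
      simp only [blockVal, Sum.elim_inl, Prod.Lex.toLex_lt_toLex, lt_irrefl, and_false,
        or_false] at hlt
      simp only [Sum.elim_inl, hlev i hi, hlev j hj]
      exact hb.1 hlt
    · have hb := orderBits_snd ((D₀.bits_R r₀ hr₀ i).symm.trans (D.bits_R r' hr' i))
      have hne := hπ₀ (D₀.s - i) (by omega)
      simp only [blockVal, Sum.elim_inl, Sum.elim_inr, Prod.Lex.toLex_lt_toLex] at hlt
      simp only [Sum.elim_inl, Sum.elim_inr, hlev i hi, id]
      exact hb.1 (by omega)
    · have hb := orderBits_snd ((D₀.bits_R r₀ hr₀ j).symm.trans (D.bits_R r hr j))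
      have hne := hπ r hr (D.s - j) (by omega)
      simp only [blockVal, Sum.elim_inl, Sum.elim_inr, Prod.Lex.toLex_lt_toLex] at hlt
      simp only [Sum.elim_inl, Sum.elim_inr, hlev j hj, id]
      have := hb.not.1 (by omega)
      omega
    · simp only [blockVal, Sum.elim_inr, Prod.Lex.toLex_lt_toLex, lt_irrefl, false_or,
        true_and] at hlt
      exact hlt

/-- The initial points of `π`, together with a geodesic whose fan has been exchanged for another one
of the same type, have all their patterns in `X`. -/
theorem Fan.age_subset {X : Set FinPerm} (hX : X = SubNat π)
    (hlev : ∀ i j, Inv π i j → lev j ≤ lev i + 1) {k b u Λ : ℕ}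
    (hk : SeqAge π (tailSet π k) ⊆ Av (finalComponents X))
    (hb : ∀ c ∈ finalComponents X, c.1 ≤ b) (hΛ : ∀ e, Λ < lev e → e ∈ tailSet π k)
    (hΛu : ∀ e < u, lev e ≤ Λ) (hL : Λ + b + 3 ≤ L) (hm : m = b + 2)
    (D₀ : Fan π lev y L m T 1) {r₀ : ℕ} (hr₀ : r₀ ∈ D₀.R) (D : Fan π lev y L m T n) :
    Age (blockPos r₀) (blockVal π r₀)
      {x | (∃ e, (e < u ∨ ∃ j ≤ D₀.s, e = D₀.z j) ∧ x = Sum.inl e) ∨ ∃ r ∈ D.R, x = Sum.inr r} ⊆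
      X := by
  subst hX
  have hcl := isClosedClass_subNat π
  have hs₀ := D₀.le_s
  have hs := D.le_s
  have hr₀lev : D₀.s ≤ lev r₀ + 1 ∧ lev r₀ ≤ D₀.s + 1 := by
    have h1 := hlev _ _ (D₀.inv_R r₀ hr₀)
    have h2 := hlev _ _ (D₀.inv_R r₀ hr₀).symm
    have h3 := D₀.lev_z _ le_rfl
    omega
  have hr₀t : r₀ ∈ tailSet π k := hΛ r₀ (by omega)
  refine age_subset_of_local hcl (subNat_nonempty π) fun c hc f hfE hf => ?_
  have hcX : c ∉ SeqAge π (tailSet π k) := fun h => hk h c hc (Involved.refl c)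
  by_cases hA : ∃ i r, f i = Sum.inr r
  · exfalso
    obtain ⟨i₁, r₁, hr₁⟩ := hA
    -- Giving block points the level of r₀ keeps the change across an inversion at most one, since
    -- inversions outside the block project to inversions of π.
    have hl := hc.2.1.lt_add_size (fun i => Sum.elim lev (fun _ => lev r₀) (f i)) (by
      intro i j hij hji
      have hp := hf.1 i j hij
      have hq := hf.2 j i hji
      have hE1 := hfE i
      have hE2 := hfE j
      revert hp hq hE1 hE2
      generalize f i = x
      generalize f j = x'
      rcases x with e | r <;> rcases x' with e' | r' <;>
        simp only [blockPos, blockVal, Sum.elim_inl, Sum.elim_inr, Prod.Lex.toLex_lt_toLex] <;>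
        intro hp hq hE1 hE2
      · have : Inv π e e' := Or.inl ⟨by omega, by omega⟩
        exact ⟨hlev _ _ this.symm, hlev _ _ this⟩
      · by_cases he : e = r₀
        · subst he; omega
        · have := π.injective.ne he
          have : Inv π e r₀ := Or.inl ⟨by omega, by omega⟩
          exact ⟨hlev _ _ this.symm, hlev _ _ this⟩
      · by_cases he : e' = r₀
        · subst he; omega
        · have := π.injective.ne he
          have : Inv π r₀ e' := Or.inl ⟨by omega, by omega⟩
          exact ⟨hlev _ _ this.symm, hlev _ _ this⟩
      · omega) i₁
    have hcb := hb c hc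
    rw [hr₁, Sum.elim_inr] at hl
    -- The component stays within b levels of r₀. It therefore misses the prefix and uses only the
    -- last b + 2 geodesic points and the block. This part embeds near the end of the geodesic of
    -- `D`, in the tail of π.
    have hc' := D₀.block_age_subset hr₀ D (a := c) ⟨f, fun i => ?_, hf⟩
    · refine hcX (PermClass.age_subset ?_ hc')
      rintro v (⟨i, rfl⟩ | hv)
      · refine hΛ _ ?_
        rw [D.lev_z _ (by omega)]
        have := i.2
        omega
      · refine hΛ _ ?_
        have h1 := hlev _ _ (D.inv_R v hv).symm
        rw [D.lev_z _ le_rfl] at h1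
        omega
    · have h1 := hl i
      rcases hfE i with ⟨e, he, hfe⟩ | h
      · rw [hfe] at h1 ⊢
        rw [Sum.elim_inl] at h1
        rcases he with he | ⟨j, hj, rfl⟩
        · have := hΛu e he
          omega
        · rw [D₀.lev_z j hj] at h1
          exact Or.inl ⟨⟨D₀.s - j, by omega⟩, by simp, by simp [Nat.sub_sub_self hj]⟩
      · exact Or.inr h
  · have hinl : ∀ i, ∃ e, f i = Sum.inl e := fun i => by
      rcases hfi : f i with e | r
      · exact ⟨e, rfl⟩
      · exact absurd ⟨i, r, hfi⟩ hA
    have hinlAge : Age (blockPos r₀) (blockVal π r₀) (Set.range Sum.inl) ⊆ SeqAge π Set.univ := by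
      refine age_mono (Sum.elim id id) (fun _ _ => trivial) ?_ ?_ <;>
      · rintro _ ⟨e, rfl⟩ _ ⟨e', rfl⟩ h
        simp only [blockPos, blockVal, Sum.elim_inl, Prod.Lex.toLex_lt_toLex] at h
        simp only [Sum.elim_inl, id]
        omega
    refine ⟨Set.range Sum.inl, fun i => ?_, ?_, hinlAge.trans (subNat_eq_age π).ge⟩
    · obtain ⟨e, he⟩ := hinl i
      exact ⟨e, he.symm⟩
    · rintro (e | r) - hlow
      · exact ⟨e, rfl⟩
      -- A block point below and to the left of the component puts the whole component above and to
      -- the right of r₀, hence in the tail.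
      · exfalso
        refine hcX ?_
        refine ⟨fun i => Sum.elim id id (f i), fun i => ?_,
          hf.comp (g := Sum.elim id id) (E := Set.range Sum.inl) (fun i => ?_) ?_ ?_⟩
        · beta_reduce
          obtain ⟨e, he⟩ := hinl i
          have h1 := hlow i
          rw [he] at h1 ⊢
          simp only [blockPos, blockVal, Sum.elim_inl, Sum.elim_inr,
            Prod.Lex.toLex_lt_toLex] at h1
          simp only [Sum.elim_inl, id]
          have := hr₀t.1
          have := hr₀t.2
          exact ⟨by omega, by omega⟩
        · obtain ⟨e, he⟩ := hinl i
          exact ⟨e, he.symm⟩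
        all_goals
          rintro _ ⟨e, rfl⟩ _ ⟨e', rfl⟩ h
          simp only [blockPos, blockVal, Sum.elim_inl, Prod.Lex.toLex_lt_toLex] at h
          simp only [Sum.elim_inl, id]
          omega

end block

/-- If `X = Sub π` is finitely based and does not split, each point of `π` is in boundedly many
inversions. -/
theorem exists_degree_bound {X : Set FinPerm} {π : Equiv.Perm ℕ} (hX : X = SubNat π)
    (hfb : IsFinitelyBased X) (hns : ¬ Splits X) :
    ∃ M, ∀ i, ∀ F : Finset ℕ, (∀ j ∈ F, Inv π i j) → F.card ≤ M := by
  classical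
  by_contra! hdeg
  obtain ⟨k, hk⟩ := exists_tail_subset_av hX hfb
  obtain ⟨b, hb⟩ := exists_size_bound hfb
  obtain ⟨y, hy⟩ := exists_no_cut hX hfb hns
  obtain ⟨u, hu⟩ := exists_prefix_rigid hX hfb hns (y + 1)
  obtain ⟨lev, hlev, hfin, hpath⟩ := exists_level hy
  obtain ⟨K, -, hKπ⟩ := exists_tail_bound π k
  -- Level above Λ guarantees membership in the tail, and the rigid prefix [0, u) has levels at most
  -- Λ.
  let Λ := (Finset.range (max u (max k K))).sup lev
  have hΛ' : ∀ e, e < max u (max k K) → lev e ≤ Λ := fun e he =>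
    Finset.le_sup (Finset.mem_range.2 he)
  obtain ⟨T, hT⟩ := exists_fan hlev hfin hpath hdeg (Λ + b + 3) (b + 2)
  obtain ⟨D₀⟩ := hT 1
  obtain ⟨r₀, hr₀⟩ := Finset.card_pos.1 D₀.card_R
  -- M depends on `D₀` only, so the fan of `D` can be chosen larger than every degree in this ball.
  let M := (finite_ball π y D₀.s).toFinset.sup fun i => (finite_inv π i).toFinset.card
  obtain ⟨D⟩ := hT (M + 1)
  have hs₀ := D₀.le_s
  have hr₀lev : D₀.s ≤ lev r₀ + 1 := by
    have h2 := hlev _ _ (D₀.inv_R r₀ hr₀).symm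
    have h3 := D₀.lev_z _ le_rfl
    omega
  have hage := Fan.age_subset (u := u) (Λ := Λ) hX hlev hk
    (fun c hc => size_le_of_mem_finalComponents hb hc)
    (fun e he => by
      have : ¬ e < max u (max k K) := fun h => absurd (hΛ' e h) (by omega)
      exact ⟨by omega, hKπ e (by omega)⟩)
    (fun e he => hΛ' e (by omega)) le_rfl rfl D₀ hr₀ D
  let A : Finset ℕ := Finset.range u ∪ (Finset.range (D₀.s + 1)).image D₀.z
  -- Since r₀ has been replaced by its block, no remaining point shares a position or a value with a
  -- block point.
  have hr₀A : r₀ ∉ A := by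
    simp only [A, Finset.mem_union, Finset.mem_range, Finset.mem_image, not_or, not_exists, not_and]
    refine ⟨fun h => ?_, fun j hj h => D₀.ne_R r₀ hr₀ j (by omega) h.symm⟩
    have := hΛ' r₀ (by omega)
    omega
  have hne : ∀ e ∈ A, e ≠ r₀ := fun e he h => hr₀A (h ▸ he)
  obtain ⟨g, -, hg1, hg2⟩ := exists_map_of_age_subset (p' := fun i : ℕ => i) (q' := π)
    (E := A.disjSum D.R) (E' := Set.univ) (p := blockPos r₀) (q := blockVal π r₀)
    (by
      rintro (e | r) h1 (e' | r') h2 h <;>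
        simp only [Finset.mem_coe, Finset.inl_mem_disjSum, Finset.inr_mem_disjSum] at h1 h2 <;>
        simp only [blockPos, Sum.elim_inl, Sum.elim_inr, EmbeddingLike.apply_eq_iff_eq,
          Prod.mk.injEq] at h
      · rw [h.1]
      · exact absurd h.1 (hne e h1)
      · exact absurd h.1.symm (hne e' h2)
      · rw [h.2])
    (by
      rintro (e | r) h1 (e' | r') h2 h <;>
        simp only [Finset.mem_coe, Finset.inl_mem_disjSum, Finset.inr_mem_disjSum] at h1 h2 <;>
        simp only [blockVal, Sum.elim_inl, Sum.elim_inr, EmbeddingLike.apply_eq_iff_eq,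
          Prod.mk.injEq] at h
      · rw [h.1]
      · exact absurd h.1 (hne e h1)
      · exact absurd h.1.symm (hne e' h2)
      · rw [h.2])
    (by
      rw [← subNat_eq_age, ← hX]
      refine (age_subset ?_).trans hage
      rintro (e | r) h <;>
        simp only [Finset.mem_coe, Finset.inl_mem_disjSum, Finset.inr_mem_disjSum] at h
      · refine Or.inl ⟨e, ?_, rfl⟩
        simp only [A, Finset.mem_union, Finset.mem_range, Finset.mem_image] at h
        rcases h with h | ⟨j, hj, rfl⟩
        · exact Or.inl h
        · exact Or.inr ⟨j, by omega, rfl⟩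
      · exact Or.inr ⟨r, h, rfl⟩)
  have hgl : EmbedsOn (fun e => g (Sum.inl e)) π π (A : Set ℕ) := by
    constructor
    · intro i hi j hj hij
      exact hg1 _ (Finset.inl_mem_disjSum.2 hi) _ (Finset.inl_mem_disjSum.2 hj)
        (by simp [blockPos, Prod.Lex.toLex_lt_toLex, hij])
    · intro i hi j hj hij
      exact hg2 _ (Finset.inl_mem_disjSum.2 hi) _ (Finset.inl_mem_disjSum.2 hj)
        (by simp [blockVal, Prod.Lex.toLex_lt_toLex, hij])
  have hzA : ∀ j ≤ D₀.s, D₀.z j ∈ A := fun j hj =>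
    Finset.mem_union_right _ (Finset.mem_image_of_mem _ (Finset.mem_range.2 (by omega)))
  have hinv : ∀ i ∈ A, ∀ j ∈ A, Inv π i j → Inv π (g (Sum.inl i)) (g (Sum.inl j)) := by
    rintro i hi j hj (h | h)
    · exact Or.inl ⟨hgl.1 i hi j hj h.1, hgl.2 j hj i hi h.2⟩
    · exact Or.inr ⟨hgl.1 j hj i hi h.1, hgl.2 i hi j hj h.2⟩
  -- Prefix rigidity fixes the start of the geodesic, and inversions map to inversions, so the j-th
  -- image is within distance j of [0, y].
  have hball : ∀ j ≤ D₀.s, g (Sum.inl (D₀.z j)) ∈ ball π y j := by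
    intro j
    induction j with
    | zero =>
      intro _
      have := hu (fun e => g (Sum.inl e)) (hgl.mono fun e he =>
        Finset.mem_coe.2 (Finset.mem_union_left _ (Finset.mem_range.2 he))) (D₀.z 0)
        (Nat.lt_succ_of_le D₀.z_zero)
      rw [this]
      exact D₀.z_zero
    | succ j ih =>
      intro hj
      exact Or.inr ⟨_, ih (by omega),
        hinv _ (hzA j (by omega)) _ (hzA (j + 1) hj) (D₀.inv_z j (by omega))⟩
  have hRinv : ∀ r ∈ D.R, Inv π (g (Sum.inl (D₀.z D₀.s))) (g (Sum.inr r)) := by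
    intro r hr
    have hl : Sum.inl (D₀.z D₀.s) ∈ A.disjSum D.R := Finset.inl_mem_disjSum.2 (hzA _ le_rfl)
    have hr' : Sum.inr r ∈ A.disjSum D.R := Finset.inr_mem_disjSum.2 hr
    rcases D₀.inv_R r₀ hr₀ with h | h
    · exact Or.inl ⟨hg1 _ hl _ hr' (by simp [blockPos, Prod.Lex.toLex_lt_toLex, h.1]),
        hg2 _ hr' _ hl (by simp [blockVal, Prod.Lex.toLex_lt_toLex, h.2])⟩
    · exact Or.inr ⟨hg1 _ hr' _ hl (by simp [blockPos, Prod.Lex.toLex_lt_toLex, h.1]),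
        hg2 _ hl _ hr' (by simp [blockVal, Prod.Lex.toLex_lt_toLex, h.2])⟩
  have hinj : Set.InjOn (fun r => g (Sum.inr r)) D.R := by
    intro r hr r' hr' h
    by_contra hne
    wlog hlt : r < r' generalizing r r'
    · exact this hr' hr h.symm (Ne.symm hne) (by omega)
    have := hg1 _ (Finset.inr_mem_disjSum.2 hr) _ (Finset.inr_mem_disjSum.2 hr')
      (by simp [blockPos, Prod.Lex.toLex_lt_toLex, hlt])
    simp only at h this
    omega
  have h1 : (D.R.image fun r => g (Sum.inr r)).card ≤
      (finite_inv π (g (Sum.inl (D₀.z D₀.s)))).toFinset.card := by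
    refine Finset.card_le_card fun x hx => ?_
    obtain ⟨r, hr, rfl⟩ := Finset.mem_image.1 hx
    simpa using hRinv r hr
  rw [Finset.card_image_of_injOn hinj] at h1
  have h2 : (finite_inv π (g (Sum.inl (D₀.z D₀.s)))).toFinset.card ≤ M :=
    Finset.le_sup (f := fun i => (finite_inv π i).toFinset.card)
      (by simpa using hball D₀.s le_rfl)
  have := D.card_R
  omega

end PermClass

/-! ### Bounded displacement, repeated windows and insertions -/

namespace PermClass

/-- The displacement of `a` is at most `D`. -/
def DispLE (a : ℕ → ℕ) (D : ℕ) : Prop := ∀ i, a i ≤ i + D ∧ i ≤ a i + D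

/-- Of the π i values below π i, at most i sit at earlier positions, so at least π i - i of them are
inverted with i. Symmetrically, at least i - π i earlier positions carry larger values. -/
theorem exists_displacement_bound {X : Set FinPerm} {π : Equiv.Perm ℕ} (hX : X = SubNat π)
    (hfb : IsFinitelyBased X) (hns : ¬ Splits X) : ∃ D, DispLE π D := by
  classical
  obtain ⟨M, hM⟩ := exists_degree_bound hX hfb hns
  refine ⟨M, fun i => ⟨?_, ?_⟩⟩
  · have h1 := hM i ((Finset.range (π i)).image π.symm \ Finset.range i) (by
      intro j hj
      simp only [Finset.mem_sdiff, Finset.mem_image, Finset.mem_range, not_lt] at hj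
      obtain ⟨⟨x, hx, rfl⟩, hij⟩ := hj
      refine Or.inl ⟨lt_of_le_of_ne hij fun he => ?_, by simpa using hx⟩
      rw [he] at hx
      simp at hx)
    have h2 := Finset.le_card_sdiff (Finset.range i) ((Finset.range (π i)).image π.symm)
    rw [Finset.card_image_of_injective _ π.symm.injective, Finset.card_range,
      Finset.card_range] at h2
    omega
  · have h1 := hM i (Finset.range i \ (Finset.range (π i)).image π.symm) (by
      intro j hj
      simp only [Finset.mem_sdiff, Finset.mem_image, Finset.mem_range, not_exists, not_and] at hj
      refine Or.inr ⟨hj.1, lt_of_not_ge fun hle => ?_⟩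
      rcases hle.eq_or_lt with h | h
      · exact absurd (π.injective h) hj.1.ne
      · exact hj.2 (π j) h (by simp))
    have h2 := Finset.le_card_sdiff ((Finset.range (π i)).image π.symm) (Finset.range i)
    rw [Finset.card_image_of_injective _ π.symm.injective, Finset.card_range,
      Finset.card_range] at h2
    omega

/-- Occurrences of indecomposable permutations are short when inversions are. -/
theorem IsIndecomposable.occ_le {c : FinPerm} (hc : IsIndecomposable c) {a : ℕ → ℕ} {s : ℕ}
    (ha : ∀ i j, i < j → a j < a i → j ≤ i + s) {f : Fin c.1 → ℕ}
    (hf : IsOcc c (fun i : ℕ => i) a f) {b : ℕ} (hb : c.1 ≤ b) (i j : Fin c.1) :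
    f j ≤ f i + s * b := by
  have hm : ∀ i j : Fin c.1, i ≤ j → f i ≤ f j := fun i j hij => by
    rcases hij.eq_or_lt with rfl | h
    · exact le_rfl
    · exact (hf.1 i j h).le
  have key : ∀ t (h : i.1 + t < c.1), f ⟨i.1 + t, h⟩ ≤ f i + s * t := by
    intro t
    induction t with
    | zero => intro h; simp
    | succ t ih =>
      intro h
      -- An inversion spans the gap between two consecutive entries, so this gap is at most s.
      obtain ⟨x, y, hx, hy, hyx⟩ := hc.exists_inversion (w := i.1 + (t + 1)) (by omega) h
      have hxy : x < y := Fin.lt_def.2 (by omega)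
      have h1 := ha (f x) (f y) (hf.1 x y hxy) (hf.2 y x hyx)
      have h2 := hm ⟨i.1 + (t + 1), h⟩ y hy
      have h3 := hm x ⟨i.1 + t, by omega⟩ (Fin.le_def.2 (by simp only; omega))
      have h4 := ih (by omega)
      rw [Nat.mul_succ]
      omega
  rcases le_total j i with hij | hij
  · exact (hm j i hij).trans (Nat.le_add_right _ _)
  · have h1 := key (j.1 - i.1) (by have := j.2; have := Fin.le_def.1 hij; omega)
    have h2 : (⟨i.1 + (j.1 - i.1), by have := j.2; have := Fin.le_def.1 hij; omega⟩ : Fin c.1) = j :=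
      Fin.ext (by have := Fin.le_def.1 hij; simp only; omega)
    rw [h2] at h1
    have h3 : s * (j.1 - i.1) ≤ s * b := Nat.mul_le_mul_left _ (by have := j.2; omega)
    omega

/-- A sequence of bounded displacement repeats windows of any length. -/
theorem exists_repeated_window {a : ℕ → ℕ} {D : ℕ} (ha : DispLE a D) (m W : ℕ) :
    ∃ x ≥ m, ∃ P > 0, ∀ t < W, a (x + t + P) = a (x + t) + P := by
  -- A window records displacements, shifted by D into the range 0, …, 2D; by pigeonhole two windows
  -- coincide.
  let win : ℕ → Fin W → Fin (2 * D + 1) := fun n t =>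
    ⟨a (m + n + t) + D - (m + n + t), by have := ha (m + n + t); omega⟩
  obtain ⟨x, y, hne, hxy⟩ := Finite.exists_ne_map_eq_of_infinite win
  wlog hlt : x < y generalizing x y
  · exact this y x hne.symm hxy.symm (by omega)
  refine ⟨m + x, by omega, y - x, by omega, fun t ht => ?_⟩
  have h1 := congrArg Fin.val (congrFun hxy ⟨t, ht⟩)
  simp only [win] at h1
  have h2 := ha (m + x + t)
  have h3 := ha (m + y + t)
  rw [show m + x + t + (y - x) = m + y + t by omega]
  omega

/-- Insert a point at position `i`, just below the value `t`, into `a` (with values rescaled). -/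
def ins (a : ℕ → ℕ) (i t j : ℕ) : ℕ :=
  if j < i then 2 * a j + 1 else if j = i then 2 * t else 2 * a (j - 1) + 1

theorem ins_of_lt {a : ℕ → ℕ} {i t j : ℕ} (h : j < i) : ins a i t j = 2 * a j + 1 := by
  simp [ins, h]

theorem ins_self {a : ℕ → ℕ} {i t : ℕ} : ins a i t i = 2 * t := by
  simp [ins]

theorem ins_of_gt {a : ℕ → ℕ} {i t j : ℕ} (h : i < j) : ins a i t j = 2 * a (j - 1) + 1 := by
  simp [ins, h.ne', show ¬ j < i by omega]

/-- Rescaled values stay within 6D + 2 of twice the position, which bounds the length of an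
inversion. This is the source of the constant in the window length. -/
theorem ins_inversion {a : ℕ → ℕ} {D i t : ℕ} (ha : DispLE a D) (ht : t ≤ i + 3 * D)
    (ht' : i ≤ t + 3 * D + 1) (x y : ℕ) (_ : x < y) (hlt : ins a i t y < ins a i t x) :
    y ≤ x + (6 * D + 2) := by
  have hb : ∀ j, ins a i t j ≤ 2 * j + 6 * D + 1 ∧ 2 * j ≤ ins a i t j + 6 * D + 2 := by
    intro j
    rcases lt_trichotomy j i with h | rfl | h
    · rw [ins_of_lt h]; have := ha j; omega
    · rw [ins_self]; omega
    · rw [ins_of_gt h]; have := ha (j - 1); omega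
  have := hb x
  have := hb y
  omega

/-- π embeds into the enlarged sequence while missing position `i`, which non-extendability forbids
inside `X`. -/
theorem not_ins_subset {X : Set FinPerm} {π : Equiv.Perm ℕ} (hX : X = SubNat π)
    (hfb : IsFinitelyBased X) (hns : ¬ Splits X) (i t : ℕ) :
    ¬ SeqAge (ins π i t) Set.univ ⊆ X := by
  intro hsub
  have hinj : Function.Injective (ins π i t) := by
    intro x y hxy
    rcases lt_trichotomy x i with h | h | h <;> rcases lt_trichotomy y i with h' | h' | h'
    · rw [ins_of_lt h, ins_of_lt h'] at hxy
      exact π.injective (by omega)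
    · subst h'; rw [ins_of_lt h, ins_self] at hxy; omega
    · rw [ins_of_lt h, ins_of_gt h'] at hxy
      have := π.injective (a₁ := x) (a₂ := y - 1) (by omega)
      omega
    · subst h; rw [ins_self, ins_of_lt h'] at hxy; omega
    · exact h.trans h'.symm
    · subst h; rw [ins_self, ins_of_gt h'] at hxy; omega
    · rw [ins_of_gt h, ins_of_lt h'] at hxy
      have := π.injective (a₁ := x - 1) (a₂ := y) (by omega)
      omega
    · subst h'; rw [ins_of_gt h, ins_self] at hxy; omega
    · rw [ins_of_gt h, ins_of_gt h'] at hxy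
      have := π.injective (a₁ := x - 1) (a₂ := y - 1) (by omega)
      omega
  have hval : ∀ j, ins π i t (if j < i then j else j + 1) = 2 * π j + 1 := fun j => by
    by_cases h : j < i
    · rw [if_pos h, ins_of_lt h]
    · rw [if_neg h, ins_of_gt (by omega), Nat.add_sub_cancel]
  have hs := surjective_of_embedding hX hfb hns hinj hsub
    (g := fun j => if j < i then j else j + 1) ⟨fun x _ y _ hxy => by
      beta_reduce; split_ifs <;> omega, fun x _ y _ hxy => by
      rw [hval, hval]; omega⟩
  obtain ⟨j, hj⟩ := hs i
  simp only at hj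
  split_ifs at hj <;> omega

/-- If an embedding of a prefix of `ρ` skips position `i` of `π`, the prefix of `ρ` with a point
inserted at `i` embeds as well. -/
theorem embedsOn_ins {ρ : ℕ → ℕ} {π : Equiv.Perm ℕ} {f : ℕ → ℕ} {n i t : ℕ}
    (hf : EmbedsOn f ρ π (Set.Iio n)) (h1 : ∀ j < i, f j = j) (h2 : ∀ j, i ≤ j → j < n → i < f j)
    (ht : ∀ j < n, ρ j < t ↔ π (f j) < π i) (hi : i < n) :
    EmbedsOn (fun j => if j < i then j else if j = i then i else f (j - 1)) (ins ρ i t) π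
      (Set.Iio (n + 1)) := by
  have hg1 : ∀ j < i, (if j < i then j else if j = i then i else f (j - 1)) = f j := fun j h => by
    rw [if_pos h, h1 j h]
  have hg2 : ∀ j, i < j → (if j < i then j else if j = i then i else f (j - 1)) = f (j - 1) :=
    fun j h => by rw [if_neg (by omega), if_neg (by omega)]
  have ht' : ∀ j < n, t ≤ ρ j → π i < π (f j) := fun j hj hle => by
    have h3 := (ht j hj).not.1 (by omega)
    refine lt_of_le_of_ne (not_lt.1 h3) fun he => ?_
    have he := π.injective he
    rcases lt_or_ge j i with h | h
    · rw [h1 j h] at he; omega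
    · have := h2 j h hj; omega
  constructor
  · intro x hx y hy hxy
    have hx : x < n + 1 := hx
    have hy : y < n + 1 := hy
    beta_reduce
    rcases lt_trichotomy x i with h | h | h <;> rcases lt_trichotomy y i with h' | h' | h'
    · rw [if_pos h, if_pos h']; exact hxy
    · subst h'; simp [h]
    · rw [hg2 y h', if_pos h]; have := h2 (y - 1) (by omega) (by omega); omega
    · omega
    · omega
    · subst h; rw [hg2 y h', if_neg (by omega), if_pos rfl]; exact h2 (y - 1) (by omega) (by omega)
    · omega
    · omega
    · rw [hg2 x h, hg2 y h']
      exact hf.1 _ (show x - 1 < n by omega) _ (show y - 1 < n by omega) (by omega)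
  · intro x hx y hy hxy
    have hx : x < n + 1 := hx
    have hy : y < n + 1 := hy
    beta_reduce
    rcases lt_trichotomy x i with h | h | h <;> rcases lt_trichotomy y i with h' | h' | h'
    · rw [ins_of_lt h, ins_of_lt h'] at hxy
      rw [hg1 x h, hg1 y h']
      exact hf.2 _ (show x < n by omega) _ (show y < n by omega) (by omega)
    · subst h'
      rw [ins_of_lt h, ins_self] at hxy
      rw [hg1 x h, if_neg (by omega), if_pos rfl]
      exact (ht x (by omega)).1 (by omega)
    · rw [ins_of_lt h, ins_of_gt h'] at hxy
      rw [hg1 x h, hg2 y h']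
      exact hf.2 _ (show x < n by omega) _ (show y - 1 < n by omega) (by omega)
    · subst h
      rw [ins_self, ins_of_lt h'] at hxy
      rw [hg1 y h', if_neg (by omega), if_pos rfl]
      exact ht' y (by omega) (by omega)
    · subst h; subst h'; omega
    · subst h
      rw [ins_self, ins_of_gt h'] at hxy
      rw [hg2 y h', if_neg (by omega), if_pos rfl]
      exact ht' (y - 1) (by omega) (by omega)
    · rw [ins_of_gt h, ins_of_lt h'] at hxy
      rw [hg2 x h, hg1 y h']
      exact hf.2 _ (show x - 1 < n by omega) _ (show y < n by omega) (by omega)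
    · subst h'
      rw [ins_of_gt h, ins_self] at hxy
      rw [hg2 x h, if_neg (by omega), if_pos rfl]
      exact (ht (x - 1) (by omega)).1 (by omega)
    · rw [ins_of_gt h, ins_of_gt h'] at hxy
      rw [hg2 x h, hg2 y h']
      exact hf.2 _ (show x - 1 < n by omega) _ (show y - 1 < n by omega) (by omega)

/-! ### Cutting out the stretch between two equal windows -/

section splice

variable {X : Set FinPerm} {π : Equiv.Perm ℕ} (hX : X = SubNat π) {D k b a P W : ℕ}
  (hD : DispLE π D) (hk : SeqAge π (tailSet π k) ⊆ Av (finalComponents X))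
  (hb : ∀ c ∈ finalComponents X, c.1 ≤ b) {ρ : ℕ → ℕ} (ha : k + D ≤ a)
  (hW : 2 * ((6 * D + 2) * b) + 10 * D + 10 ≤ W)
  (hρ : ∀ i < a + W, ρ i = π i) (hρ' : ∀ i, a ≤ i → π (i + P) = ρ i + P)

include hD hρ hρ' in
theorem dispLE_splice : DispLE ρ D := by
  intro i
  rcases lt_or_ge i (a + W) with h | h
  · rw [hρ i h]; exact hD i
  · have := hD (i + P)
    rw [hρ' i (by omega)] at this
    omega

include hD hρ hρ' hW in
theorem injective_splice : Function.Injective ρ := by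
  have hρD := dispLE_splice hD hρ hρ'
  intro i j hij
  wlog hlt : i ≤ j generalizing i j
  · exact (this hij.symm (by omega)).symm
  rcases lt_or_ge j (a + W) with h | h
  · rw [hρ i (by omega), hρ j h] at hij
    exact π.injective hij
  -- Equal values force positions within 2D of each other, less than W. So both positions lie where
  -- ρ is a translate of π.
  · have hi : a ≤ i := by
      have := hρD i
      have := hρD j
      omega
    have h1 := hρ' i hi
    have h2 := hρ' j (by omega)
    have := π.injective (h1.trans ((congrArg (· + P) hij).trans h2.symm))
    omega

include hD hρ hρ' hW in
theorem surjective_splice : Function.Surjective ρ := by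
  intro y
  rcases lt_or_ge y (a + D) with h | h
  · have h1 := hD (π.symm y)
    rw [Equiv.apply_symm_apply] at h1
    exact ⟨π.symm y, by rw [hρ _ (by omega), Equiv.apply_symm_apply]⟩
  · have h1 := hD (π.symm (y + P))
    rw [Equiv.apply_symm_apply] at h1
    refine ⟨π.symm (y + P) - P, ?_⟩
    have h2 := hρ' (π.symm (y + P) - P) (by omega)
    rw [Nat.sub_add_cancel (by omega), Equiv.apply_symm_apply] at h2
    omega

include hX hD hk hb ha hW hρ hρ' in
-- A component is too short to cross the whole window. Either it lies in the prefix shared with π,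
-- along with all that is below and left of it, or it lies from a on, where translating by `P` puts
-- it in the tail of π.
theorem splice_subset : SeqAge ρ Set.univ ⊆ X := by
  have hρD := dispLE_splice hD hρ hρ'
  have hcl : IsClosedClass X := hX ▸ isClosedClass_subNat π
  refine age_subset_of_local hcl (hX ▸ subNat_nonempty π) fun c hc f _ hf => ?_
  have hlen := hc.2.1.occ_le (s := 6 * D + 2) (fun i j hij hji => by
    have := hρD i
    have := hρD j
    omega) hf (hb c hc)
  by_cases hall : ∀ i, f i < a + W
  · refine ⟨Set.Iio (a + W), hall, fun x _ hx => ?_, ?_⟩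
    · exact (hx ⟨0, Nat.pos_of_ne_zero hc.1⟩).1.trans (hall _)
    · rw [hX, subNat_eq_age]
      refine age_mono id (fun _ _ => trivial) (fun _ _ _ _ h => h) fun x hx y hy h => ?_
      rw [hρ x hx, hρ y hy] at h
      exact h
  · exfalso
    push Not at hall
    obtain ⟨i, hi⟩ := hall
    -- The component spans at most (6D + 2)b ≤ W positions.
    have hfa : ∀ j, a ≤ f j := fun j => by
      have := hlen j i
      omega
    refine hk ⟨fun j => f j + P, fun j => ?_, hf.comp (E := Set.Ici a) (g := fun x => x + P) hfa
      (fun x _ y _ h => by simpa using h) (fun x hx y hy h => ?_)⟩ c hc (Involved.refl c)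
    · have h1 := hfa j
      have h2 := hD (f j + P)
      beta_reduce
      exact ⟨by omega, by omega⟩
    · rw [hρ' x hx, hρ' y hy]
      omega

include hX hD hk hb ha hW hρ hρ' in
-- `exists_limit_of_not_splits` does not apply, since ρ is not known to generate all of `X`.
-- Instead, at the first moved index i the embedding skips position i of π. Inserting that point
-- into ρ, and then into π at the corresponding place, would extend π inside `X`.
theorem splice_rigid (hfb : IsFinitelyBased X) (hns : ¬ Splits X) {f : ℕ → ℕ} {I : ℕ}
    (hf : EmbedsOn f ρ π (Set.Iio (I + a + 2 * W))) (i : ℕ) (hi : i ≤ I) : f i = i := by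
  classical
  have hρD := dispLE_splice hD hρ hρ'
  have hcl : IsClosedClass X := hX ▸ isClosedClass_subNat π
  obtain ⟨n, hn⟩ : ∃ n, n = I + a + 2 * W := ⟨_, rfl⟩
  rw [← hn] at hf
  induction i using Nat.strong_induction_on with
  | _ i ih =>
  by_contra hne
  have h1 : ∀ j < i, f j = j := fun j hj => ih j hj (by omega)
  have hfi : i < f i := by
    rcases Nat.eq_zero_or_pos i with h0 | h0
    · omega
    · have := hf.1 (i - 1) (show i - 1 < n by omega) i (show i < n by omega) (by omega)
      rw [h1 (i - 1) (by omega)] at this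
      omega
  have h2' : ∀ d, i + d < n → i + d < f (i + d) := by
    intro d
    induction d with
    | zero => intro _; exact hfi
    | succ d ihd =>
      intro h
      have := hf.1 (i + d) (show i + d < n by omega) (i + (d + 1)) h (by omega)
      have := ihd (by omega)
      omega
  have h2 : ∀ j, i ≤ j → j < n → j < f j := fun j hij hj => by
    have := h2' (j - i) (by omega)
    rwa [Nat.add_sub_cancel' hij] at this
  -- t is the height at which the skipped point of π sits among the values of ρ. Bounded
  -- displacement keeps it within 3D + 1 of i.
  obtain ⟨t, ht⟩ : ∃ t, t = ((Finset.range n).filter fun j => π (f j) < π i).sup fun j => ρ j + 1 :=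
    ⟨_, rfl⟩
  have ht1 : ∀ j < n, ρ j < t ↔ π (f j) < π i := by
    intro j hj
    rw [ht, Finset.lt_sup_iff]
    constructor
    · rintro ⟨j', hj', hlt⟩
      simp only [Finset.mem_filter, Finset.mem_range] at hj'
      rcases (Nat.lt_succ_iff.1 hlt).eq_or_lt with h | h
      · rw [injective_splice hD hW hρ hρ' h]; exact hj'.2
      · exact (hf.2 j hj j' hj'.1 h).trans hj'.2
    · intro h
      exact ⟨j, by simp [hj, h], Nat.lt_succ_self _⟩
  have ht2 : t ≤ i + 3 * D := by
    rw [ht]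
    refine Finset.sup_le fun j hj => ?_
    simp only [Finset.mem_filter, Finset.mem_range] at hj
    have := hD (f j)
    have := hD i
    have := hρD j
    have : j ≤ f j := by
      rcases lt_or_ge j i with h | h
      · rw [h1 j h]
      · exact (h2 j h hj.1).le
    omega
  have ht3 : i ≤ t + 3 * D + 1 := by
    by_contra! hlt
    have h3 := h1 (i - (2 * D + 1)) (by omega)
    have h4 := ht1 (i - (2 * D + 1)) (by omega)
    have := hD (i - (2 * D + 1))
    have := hD i
    have := hρD (i - (2 * D + 1))
    rw [h3] at h4
    have := h4.2 (by omega)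
    omega
  have hF := embedsOn_ins hf h1 (fun j hij hj => by have := h2 j hij hj; omega) ht1 (by omega)
  set F := fun j => if j < i then j else if j = i then i else f (j - 1) with hFdef
  have hFge : ∀ j, j < n + 1 → j ≤ F j := by
    intro j hj
    simp only [hFdef]
    split_ifs with h h'
    · exact le_rfl
    · exact h'.le
    · have := h2 (j - 1) (by omega) (by omega)
      omega
  -- In the first case the common prefix reaches more than (6D + 2)b beyond i, and the point is
  -- inserted into π at i itself. In the second, i is that far past a, and the point is inserted at
  -- i + P.
  rcases lt_or_ge i (a + ((6 * D + 2) * b + 5 * D + 3)) with hia | hia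
  · refine not_ins_subset hX hfb hns i t (age_subset_of_local hcl (hX ▸ subNat_nonempty π)
      fun c hc g _ hg => ?_)
    have hlen := hc.2.1.occ_le (ins_inversion hD ht2 ht3) hg (hb c hc)
    by_cases hall : ∀ j, g j < a + W
    · refine ⟨Set.Iio (a + W), hall, fun x _ hx => ?_, ?_⟩
      · exact (hx ⟨0, Nat.pos_of_ne_zero hc.1⟩).1.trans (hall _)
      · have hins : ∀ j < a + W, ins π i t j = ins ρ i t j := by
          intro j hj
          rcases lt_trichotomy j i with h | rfl | h
          · rw [ins_of_lt h, ins_of_lt h, hρ j hj]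
          · rw [ins_self, ins_self]
          · rw [ins_of_gt h, ins_of_gt h, hρ (j - 1) (by omega)]
        rw [hX, subNat_eq_age]
        refine age_mono F (fun _ _ => trivial) (fun x hx y hy h => ?_) fun x hx y hy h => ?_
        · have hx : x < a + W := hx
          have hy : y < a + W := hy
          exact hF.1 x (show x < n + 1 by omega) y (show y < n + 1 by omega) h
        · have hx : x < a + W := hx
          have hy : y < a + W := hy
          rw [hins x hx, hins y hy] at h
          exact hF.2 x (show x < n + 1 by omega) y (show y < n + 1 by omega) h
    · exfalso
      push Not at hall
      obtain ⟨j₀, hj₀⟩ := hall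
      -- A component reaching past a + W lies wholly after the new point, so it is a pattern of the
      -- tail of π.
      have hga : ∀ j, i < g j ∧ a + D + 1 ≤ g j := fun j => by
        have := hlen j j₀
        omega
      refine hk ⟨fun j => g j - 1, fun j => ?_, hg.comp (E := {x | i < x}) (g := fun x => x - 1)
        (fun j => (hga j).1) (fun x hx y hy h => ?_) (fun x hx y hy h => ?_)⟩ c hc (Involved.refl c)
      · have h3 := hga j
        have h4 := hD (g j - 1)
        beta_reduce
        exact ⟨by omega, by omega⟩
      · have hx : i < x := hx
        omega
      · rw [ins_of_gt hx, ins_of_gt hy] at h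
        omega
  · refine not_ins_subset hX hfb hns (i + P) (t + P) (age_subset_of_local hcl
      (hX ▸ subNat_nonempty π) fun c hc g _ hg => ?_)
    have hlen := hc.2.1.occ_le (ins_inversion hD (i := i + P) (t := t + P) (by omega) (by omega))
      hg (hb c hc)
    by_cases hall : ∀ j, g j < i + P
    · refine ⟨Set.Iio (i + P), hall, fun x _ hx => ?_, ?_⟩
      · exact (hx ⟨0, Nat.pos_of_ne_zero hc.1⟩).1.trans (hall _)
      · rw [hX, subNat_eq_age]
        refine age_mono id (fun _ _ => trivial) (fun _ _ _ _ h => h) fun x hx y hy h => ?_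
        rw [ins_of_lt hx, ins_of_lt hy] at h
        simp only [id]
        omega
    · exfalso
      push Not at hall
      obtain ⟨j₀, hj₀⟩ := hall
      by_cases hall' : ∀ j, i + P < g j
      · refine hk ⟨fun j => g j - 1, fun j => ?_, hg.comp (E := {x | i + P < x})
          (g := fun x => x - 1) hall' (fun x hx y hy h => ?_) (fun x hx y hy h => ?_)⟩ c hc
          (Involved.refl c)
        · have h3 := hall' j
          have h4 := hD (g j - 1)
          beta_reduce
          exact ⟨by omega, by omega⟩
        · have hx : i + P < x := hx
          omega
        · rw [ins_of_gt hx, ins_of_gt hy] at h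
          omega
      · push Not at hall'
        obtain ⟨j₁, hj₁⟩ := hall'
        -- A component around i + P stays where the enlarged π is a translate of the enlarged ρ.
        -- There `F` maps it into π, and into the tail because `F` never moves points to the left.
        have hga : ∀ j, g j ∈ Set.Ico (a + P + D) (n + P) := fun j => by
          have := hlen j j₀
          have := hlen j₁ j
          exact ⟨by omega, by omega⟩
        have hins : ∀ j, a + P + D ≤ j → ins π (i + P) (t + P) j = ins ρ i t (j - P) + 2 * P := by
          intro j hj
          rcases lt_trichotomy j (i + P) with h | rfl | h
          · rw [ins_of_lt h, ins_of_lt (by omega)]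
            have := hρ' (j - P) (by omega)
            rw [Nat.sub_add_cancel (by omega)] at this
            omega
          · rw [ins_self, Nat.add_sub_cancel, ins_self]
            omega
          · rw [ins_of_gt h, ins_of_gt (by omega)]
            have := hρ' (j - P - 1) (by omega)
            rw [show j - P - 1 + P = j - 1 by omega] at this
            omega
        refine hk ⟨fun j => F (g j - P), fun j => ?_, hg.comp (E := Set.Ico (a + P + D) (n + P))
          (g := fun x => F (x - P)) hga (fun x hx y hy h => ?_) (fun x hx y hy h => ?_)⟩ c hc
          (Involved.refl c)
        · have h3 := hga j
          rw [Set.mem_Ico] at h3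
          have h4 := hFge (g j - P) (by omega)
          have h5 := hD (F (g j - P))
          beta_reduce
          exact ⟨by omega, by omega⟩
        · rw [Set.mem_Ico] at hx hy
          exact hF.1 _ (show x - P < n + 1 by omega) _ (show y - P < n + 1 by omega) (by omega)
        · rw [Set.mem_Ico] at hx hy
          rw [hins x hx.1, hins y hy.1] at h
          exact hF.2 _ (show x - P < n + 1 by omega) _ (show y - P < n + 1 by omega) (by omega)

end splice

/-- Rigidity makes the spliced sequence order isomorphic to π by the identity on positions. Both are
bijections of ℕ, so they coincide, and ρ = π is the periodicity from `a` on. -/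
theorem isUltimatelyPeriodic_of_not_splits {X : Set FinPerm} {π : Equiv.Perm ℕ}
    (hX : X = SubNat π) (hfb : IsFinitelyBased X) (hns : ¬ Splits X) :
    IsUltimatelyPeriodic π := by
  obtain ⟨D, hD⟩ := exists_displacement_bound hX hfb hns
  obtain ⟨k, hk⟩ := exists_tail_subset_av hX hfb
  obtain ⟨b, hb⟩ := exists_size_bound hfb
  have hb' : ∀ c ∈ finalComponents X, c.1 ≤ b := fun c hc => size_le_of_mem_finalComponents hb hc
  obtain ⟨W, hW⟩ : ∃ W, W = 2 * ((6 * D + 2) * b) + 10 * D + 10 := ⟨_, rfl⟩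
  obtain ⟨a, ha, P, hP, hwin⟩ := exists_repeated_window hD (k + D) W
  let ρ : ℕ → ℕ := fun i => if i < a + W then π i else π (i + P) - P
  have hρ : ∀ i < a + W, ρ i = π i := fun i hi => if_pos hi
  have hρ' : ∀ i, a ≤ i → π (i + P) = ρ i + P := fun i hi => by
    by_cases h : i < a + W
    · have := hwin (i - a) (by omega)
      rw [Nat.add_sub_cancel' hi] at this
      rw [hρ i h, this]
    · have := hD (i + P)
      simp only [ρ, if_neg h]
      omega
  obtain ⟨F, hF⟩ := exists_prefix_embeddings hX (injective_splice hD hW.ge hρ hρ')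
    (splice_subset hX hD hk hb' ha hW.ge hρ hρ') (fun _ => Set.subset_univ _)
  have hfix : ∀ I i, i ≤ I → F (I + a + 2 * W) i = i := fun I i hi =>
    splice_rigid hX hD hk hb' ha hW.ge hρ hρ' hfb hns (hF _) i hi
  have hord : ∀ i j, ρ i < ρ j → π i < π j := fun i j hij => by
    have := (hF (max i j + a + 2 * W)).2 i (show i < _ by omega) j (show j < _ by omega) hij
    rwa [hfix _ i (le_max_left _ _), hfix _ j (le_max_right _ _)] at this
  have heq : ∀ i, ρ i = π i := perm_eq_of_order (surjective_splice hD hW.ge hρ hρ')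
    fun i j hij => by
      by_contra hcon
      rcases (not_lt.1 hcon).eq_or_lt with h | h
      · rw [injective_splice hD hW.ge hρ hρ' h] at hij
        exact lt_irrefl _ hij
      · exact lt_asymm hij (hord _ _ h)
  exact ⟨a, P, hP, fun n hn => by rw [hρ' n hn, heq]⟩

end PermClass

/-! ### Rationality of the generating function -/

namespace PermClass

open Polynomial in
/-- The generating function of a linear functional of a linear recurrence is rational. -/
theorem rational_of_recurrence {Q : Type*} [Fintype Q] [DecidableEq Q] (M : Matrix Q Q ℚ)
    (v : ℕ → Q → ℚ) (hv : ∀ n, v (n + 1) = M.mulVec (v n)) :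
    ∃ p q : ℚ[X], q.coeff 0 ≠ 0 ∧
      (q : PowerSeries ℚ) * PowerSeries.mk (fun n => ∑ i, v n i) = (p : PowerSeries ℚ) := by
  let A : Matrix Q Q ℚ[X] := 1 - (X : ℚ[X]) • M.map C
  let φ : ℚ[X] →+* PowerSeries ℚ := Polynomial.coeToPowerSeries.ringHom
  let V : Q → PowerSeries ℚ := fun i => PowerSeries.mk fun n => v n i
  -- The vector of series satisfies (1 - xM)V = v₀. Multiplying by the adjugate exhibits det(1 -
  -- xM), with constant term 1, as a common denominator.
  have hAV : (φ.mapMatrix A).mulVec V = fun i => φ (C (v 0 i)) := by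
    have h1 : φ.mapMatrix A = 1 - (PowerSeries.X : PowerSeries ℚ) • M.map (PowerSeries.C) := by
      simp only [A, map_sub, map_one]
      congr 1
      ext i j : 2
      simp [φ, Matrix.map_apply]
      exact mul_comm _ _
    rw [h1, Matrix.sub_mulVec, Matrix.one_mulVec, Matrix.smul_mulVec]
    ext i n
    simp only [Pi.sub_apply, Pi.smul_apply, smul_eq_mul, map_sub]
    cases n with
    | zero => simp [V, φ]
    | succ n =>
      rw [PowerSeries.coeff_succ_X_mul]
      simp only [V, PowerSeries.coeff_mk, Matrix.mulVec, dotProduct, Matrix.map_apply, map_sum,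
        PowerSeries.coeff_C_mul, hv]
      simp [φ]
  have hdet : ∀ i, φ A.det * V i = φ ((A.adjugate.mulVec fun i => C (v 0 i)) i) := by
    intro i
    have h2 := congrArg (fun w => (φ.mapMatrix A).adjugate.mulVec w i) hAV
    simp only [Matrix.mulVec_mulVec, Matrix.adjugate_mul, Matrix.smul_mulVec, Matrix.one_mulVec,
      Pi.smul_apply, smul_eq_mul] at h2
    rw [← RingHom.map_det, ← RingHom.map_adjugate] at h2
    rw [h2]
    simp [Matrix.mulVec, dotProduct, map_sum]
  refine ⟨∑ i, (A.adjugate.mulVec fun i => C (v 0 i)) i, A.det, ?_, ?_⟩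
  · have : A.det = M.charpolyRev := rfl
    rw [this, Polynomial.coeff_zero_eq_eval_zero, Matrix.eval_charpolyRev]
    exact one_ne_zero
  · have hV : PowerSeries.mk (fun n => ∑ i, v n i) = ∑ i, V i := by
      ext n
      simp [V, map_sum]
    have h : φ A.det * ∑ i, V i = φ (∑ i, (A.adjugate.mulVec fun i => C (v 0 i)) i) := by
      rw [Finset.mul_sum, map_sum]
      exact Finset.sum_congr rfl fun i _ => hdet i
    rw [hV]
    exact h

/-- Prepend the value `e` to a permutation. -/
def consPerm {n : ℕ} (e : Fin (n + 1)) (τ : Equiv.Perm (Fin n)) : Equiv.Perm (Fin (n + 1)) :=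
  ((finSuccEquiv' 0).trans (Equiv.optionCongr τ)).trans (finSuccEquiv' e).symm

theorem consPerm_zero {n : ℕ} (e : Fin (n + 1)) (τ : Equiv.Perm (Fin n)) : consPerm e τ 0 = e := by
  simp [consPerm]

theorem consPerm_succ {n : ℕ} (e : Fin (n + 1)) (τ : Equiv.Perm (Fin n)) (i : Fin n) :
    consPerm e τ i.succ = e.succAbove (τ i) := by
  have : finSuccEquiv' (0 : Fin (n + 1)) i.succ = some i := by
    rw [← Fin.succAbove_zero, finSuccEquiv'_succAbove]
  simp [consPerm, this]

theorem consPerm_bijective (n : ℕ) :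
    Function.Bijective fun x : Fin (n + 1) × Equiv.Perm (Fin n) => consPerm x.1 x.2 := by
  rw [Fintype.bijective_iff_injective_and_card]
  constructor
  · rintro ⟨e, τ⟩ ⟨e', τ'⟩ h
    have h0 : e = e' := by
      rw [← consPerm_zero e τ, ← consPerm_zero e' τ']
      exact congrArg (fun σ : Equiv.Perm _ => σ 0) h
    subst h0
    congr 1
    ext i
    have h1 := congrArg (fun σ : Equiv.Perm _ => σ i.succ) h
    simp only [consPerm_succ] at h1
    rw [Fin.succAbove_right_injective h1]
  · simp [Fintype.card_perm, Nat.factorial_succ]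

theorem succ_isOcc_consPerm {n : ℕ} (e : Fin (n + 1)) (τ : Equiv.Perm (Fin n)) :
    IsOcc ⟨n, τ⟩ (fun i : Fin (n + 1) => i) (consPerm e τ) Fin.succ := by
  refine ⟨fun i j hij => Fin.succ_lt_succ_iff.2 hij, fun i j hij => ?_⟩
  rw [consPerm_succ, consPerm_succ]
  exact Fin.strictMono_succAbove e hij

theorem involved_consPerm {n : ℕ} (e : Fin (n + 1)) (τ : Equiv.Perm (Fin n)) :
    Involved ⟨n, τ⟩ ⟨n + 1, consPerm e τ⟩ :=
  involved_iff.2 ⟨_, fun _ => trivial, succ_isOcc_consPerm e τ⟩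

/-- The patterns of size at most `b` in `α`, with values recorded up to `D`. -/
def valuedPatterns (b D : ℕ) (α : FinPerm) :
    Set (Σ β : {β : FinPerm // β.1 ≤ b}, Fin β.1.1 → Fin (D + 1)) :=
  {x | ∃ f, IsOcc x.1.1 (fun i : Fin α.1 => i) α.2 f ∧ ∀ i, min (α.2 (f i)).1 D = (x.2 i).1}

theorem exists_isOcc_of_valuedPatterns {b D : ℕ} {α α' : FinPerm}
    (h : valuedPatterns b D α ⊆ valuedPatterns b D α') {β : FinPerm} (hβ : β.1 ≤ b)
    {f : Fin β.1 → Fin α.1} (hf : IsOcc β (fun i => i) α.2 f) :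
    ∃ f' : Fin β.1 → Fin α'.1, IsOcc β (fun i => i) α'.2 f' ∧
      ∀ i, min (α'.2 (f' i)).1 D = min (α.2 (f i)).1 D := by
  obtain ⟨f', hf', hv⟩ := h (a := ⟨⟨β, hβ⟩, fun i => ⟨min (α.2 (f i)).1 D, by omega⟩⟩)
    ⟨f, hf, fun i => rfl⟩
  exact ⟨f', hf', hv⟩

theorem min_succAbove {n n' D : ℕ} {e : Fin (n + 1)} {e' : Fin (n' + 1)} (he : e.1 = e'.1)
    (heD : e.1 ≤ D) {x : Fin n} {x' : Fin n'} (h : min x'.1 D = min x.1 D) :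
    min (e'.succAbove x').1 D = min (e.succAbove x).1 D := by
  simp only [Fin.succAbove, Fin.lt_def, Fin.val_castSucc]
  split_ifs <;> simp only [Fin.val_castSucc, Fin.val_succ] <;> omega

theorem lt_succAbove_iff {n : ℕ} {e : Fin (n + 1)} {x : Fin n} :
    e < e.succAbove x ↔ e.1 ≤ x.1 := by
  simp only [Fin.succAbove, Fin.lt_def, Fin.val_castSucc]
  split_ifs <;> simp only [Fin.val_castSucc, Fin.val_succ] <;> omega

/-- An occurrence either avoids the new first entry or starts with it. In both cases the old entries
need comparing with `e` only, and as `e` is at most `D` the capped values decide this. -/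
theorem valuedPatterns_consPerm {b D n n' : ℕ} {τ : Equiv.Perm (Fin n)} {τ' : Equiv.Perm (Fin n')}
    (h : valuedPatterns b D ⟨n, τ⟩ ⊆ valuedPatterns b D ⟨n', τ'⟩) {e : Fin (n + 1)}
    {e' : Fin (n' + 1)} (he : e.1 = e'.1) (heD : e.1 ≤ D) :
    valuedPatterns b D ⟨n + 1, consPerm e τ⟩ ⊆ valuedPatterns b D ⟨n' + 1, consPerm e' τ'⟩ := by
  rintro ⟨⟨⟨m, β⟩, hβ⟩, v⟩ ⟨f, hf, hv⟩
  change Fin m → Fin (n + 1) at f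
  change Fin m → Fin (D + 1) at v
  change m ≤ b at hβ
  by_cases h0 : ∀ i, f i ≠ 0
  · choose g hg using fun i => Fin.exists_succ_eq.2 (h0 i)
    have hgocc : IsOcc ⟨m, β⟩ (fun i : Fin n => i) τ g := by
      refine ⟨fun i j hij => ?_, fun i j hij => ?_⟩
      · have := hf.1 i j hij
        rw [← hg, ← hg] at this
        exact Fin.succ_lt_succ_iff.1 this
      · have := hf.2 i j hij
        simp only at this
        rw [← hg, ← hg, consPerm_succ, consPerm_succ] at this
        exact (Fin.strictMono_succAbove e).lt_iff_lt.1 this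
    obtain ⟨g', hg', hgv⟩ := exists_isOcc_of_valuedPatterns h (β := ⟨m, β⟩) hβ hgocc
    refine ⟨fun i => (g' i).succ, hg'.comp (E := Set.univ) (fun _ => trivial)
      (fun x _ y _ h => (succ_isOcc_consPerm e' τ').1 x y h)
      (fun x _ y _ h => (succ_isOcc_consPerm e' τ').2 x y h), fun i => ?_⟩
    have h1 := hv i
    simp only at h1
    rw [← hg, consPerm_succ] at h1
    simp only
    rw [consPerm_succ, ← h1]
    exact min_succAbove he heD (hgv i)
  · push Not at h0
    obtain ⟨i₀, hi₀⟩ := h0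
    obtain ⟨k, rfl⟩ : ∃ k, m = k + 1 := ⟨m - 1, by have := i₀.2; omega⟩
    obtain ⟨⟨p, β'⟩, rfl⟩ := (consPerm_bijective k).2 β
    have hf0 : f 0 = 0 := by
      rcases (Fin.zero_le i₀).eq_or_lt with h | h
      · rw [h]; exact hi₀
      · have := hf.1 0 i₀ h
        rw [hi₀] at this
        exact absurd this (Fin.not_lt_zero _)
    have hfs : ∀ i : Fin k, f i.succ ≠ 0 := fun i hi => by
      have := hf.1 0 i.succ (Fin.succ_pos i)
      rw [hi] at this
      exact absurd this (Fin.not_lt_zero _)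
    choose g hg using fun i => Fin.exists_succ_eq.2 (hfs i)
    have hgocc : IsOcc ⟨k, β'⟩ (fun i : Fin n => i) τ g := by
      refine ⟨fun i j hij => ?_, fun i j hij => ?_⟩
      · have := hf.1 i.succ j.succ (Fin.succ_lt_succ_iff.2 hij)
        rw [← hg, ← hg] at this
        exact Fin.succ_lt_succ_iff.1 this
      · have := hf.2 i.succ j.succ ((succ_isOcc_consPerm p β').2 i j hij)
        simp only at this
        rw [← hg, ← hg, consPerm_succ, consPerm_succ] at this
        exact (Fin.strictMono_succAbove e).lt_iff_lt.1 this
    obtain ⟨g', hg', hgv⟩ := exists_isOcc_of_valuedPatterns h (β := ⟨k, β'⟩)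
      (by simp only; omega) hgocc
    have hg'v : ∀ i, min (τ' (g' i)).1 D = min (τ (g i)).1 D := hgv
    refine ⟨Fin.cons 0 fun i => (g' i).succ, ⟨?_, ?_⟩, ?_⟩
    · intro i j
      refine Fin.cases ?_ (fun i => ?_) i <;> refine Fin.cases ?_ (fun j => ?_) j <;> intro hij
      · exact absurd hij (lt_irrefl _)
      · simp
      · exact absurd hij (Fin.not_lt_zero _)
      · simp only [Fin.cons_succ]
        exact Fin.succ_lt_succ_iff.2 (hg'.1 i j (Fin.succ_lt_succ_iff.1 hij))
    -- Capping at D does not affect comparison with e ≤ D.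
    · have hlow : ∀ j, e.1 ≤ (τ (g j)).1 ↔ e'.1 ≤ (τ' (g' j)).1 := fun j => by
        have := hg'v j
        omega
      have hp : ∀ j : Fin k, p < p.succAbove (β' j) ↔ e.1 ≤ (τ (g j)).1 := fun j => by
        have := hf.val_iff 0 j.succ
        simp only [consPerm_zero, consPerm_succ] at this
        rw [hf0, ← hg, consPerm_zero, consPerm_succ, lt_succAbove_iff] at this
        exact this.symm
      intro i j
      simp only
      refine Fin.cases ?_ (fun i => ?_) i <;> refine Fin.cases ?_ (fun j => ?_) j <;> intro hij
      · exact absurd hij (lt_irrefl _)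
      · rw [consPerm_zero, consPerm_succ] at hij
        rw [Fin.cons_zero, Fin.cons_succ, consPerm_zero, consPerm_succ, lt_succAbove_iff]
        exact (hlow j).1 ((hp j).1 hij)
      · rw [consPerm_zero, consPerm_succ] at hij
        rw [Fin.cons_zero, Fin.cons_succ, consPerm_zero, consPerm_succ]
        have h1 := (hp i).not.1 (lt_asymm hij)
        rw [hlow, ← lt_succAbove_iff] at h1
        exact lt_of_le_of_ne (not_lt.1 h1) (Fin.succAbove_ne _ _)
      · rw [consPerm_succ, consPerm_succ] at hij
        rw [Fin.cons_succ, Fin.cons_succ, consPerm_succ, consPerm_succ]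
        exact Fin.strictMono_succAbove e' (hg'.2 i j ((Fin.strictMono_succAbove p).lt_iff_lt.1 hij))
    · intro i
      rw [← hv i]
      simp only
      refine Fin.cases ?_ (fun i => ?_) i
      · rw [Fin.cons_zero, hf0, consPerm_zero, consPerm_zero, he]
      · rw [Fin.cons_succ, ← hg, consPerm_succ, consPerm_succ]
        exact min_succAbove he heD (hg'v i)

/-- Basis elements have size at most `b`, so the recorded patterns detect every obstruction to
membership. -/
theorem mem_of_valuedPatterns_subset {X : Set FinPerm} (hX : IsClosedClass X) {b D : ℕ}
    (hb : ∀ β ∈ basis X, β.1 ≤ b) {α α' : FinPerm}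
    (h : valuedPatterns b D α ⊆ valuedPatterns b D α') (hα' : α' ∈ X) : α ∈ X := by
  by_contra hα
  obtain ⟨β, hβ, hβα⟩ := exists_basis_involved α hα
  obtain ⟨f, -, hf⟩ := involved_iff.1 hβα
  obtain ⟨f', hf', -⟩ := exists_isOcc_of_valuedPatterns h (hb β hβ) hf
  exact hβ.1 (hX α' hα' β (involved_iff.2 ⟨f', fun _ => trivial, hf'⟩))

/-- A finitely based class whose elements have bounded Lehmer codes has a rational generating
function. -/
theorem hasRationalGF_of_lehmer_bound {X : Set FinPerm} (hX : IsClosedClass X)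
    (hfb : IsFinitelyBased X) {D : ℕ}
    (hD : ∀ n (e : Fin (n + 1)) τ, (⟨n + 1, consPerm e τ⟩ : FinPerm) ∈ X → e.1 ≤ D) :
    HasRationalGF X := by
  classical
  obtain ⟨b, hb⟩ := exists_size_bound hfb
  have hfinite : Finite {β : FinPerm // β.1 ≤ b} := (finite_setOf_size_le b).to_subtype
  let Q := Fin (D + 1) × Set (Σ β : {β : FinPerm // β.1 ≤ b}, Fin β.1.1 → Fin (D + 1))
  have : Fintype Q := Fintype.ofFinite Q
  -- The capped length records which new first values e ≤ D are available, the actual constraint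
  -- being e ≤ n.
  let st : FinPerm → Q := fun α => (⟨min α.1 D, by omega⟩, valuedPatterns b D α)
  let step : Q → Fin (D + 1) → Q → Prop := fun q e q' => ∃ n, ∃ τ : Equiv.Perm (Fin n),
    ∃ e' : Fin (n + 1), e'.1 = e.1 ∧ st ⟨n, τ⟩ = q ∧ (⟨n + 1, consPerm e' τ⟩ : FinPerm) ∈ X ∧
      st ⟨n + 1, consPerm e' τ⟩ = q'
  -- Transitions depend on the state alone: a transition witnessed by one permutation is available
  -- for every permutation in that state.
  have hstep : ∀ n (τ : Equiv.Perm (Fin n)) e q', step (st ⟨n, τ⟩) e q' →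
      ∃ e' : Fin (n + 1), e'.1 = e.1 ∧ (⟨n + 1, consPerm e' τ⟩ : FinPerm) ∈ X ∧
        st ⟨n + 1, consPerm e' τ⟩ = q' := by
    rintro n τ e q' ⟨n₀, τ₀, e₀, he₀, hst, hmem, rfl⟩
    have h1 : min n₀ D = min n D := congrArg (fun q : Q => q.1.1) hst
    have h2 : valuedPatterns b D ⟨n₀, τ₀⟩ = valuedPatterns b D ⟨n, τ⟩ :=
      congrArg (fun q : Q => q.2) hst
    have h3 := e.2
    have h4 := e₀.2
    refine ⟨⟨e.1, by omega⟩, rfl, ?_⟩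
    have h5 := valuedPatterns_consPerm h2.le (e := e₀) (e' := ⟨e.1, by omega⟩) he₀ (by omega)
    have h6 := valuedPatterns_consPerm h2.ge (e := ⟨e.1, by omega⟩) (e' := e₀) he₀.symm
      (by simp only; omega)
    refine ⟨mem_of_valuedPatterns_subset hX hb h6 hmem, Prod.ext (Fin.ext ?_) (h6.antisymm h5)⟩
    simp only [st]
    omega
  let N : ℕ → Q → ℕ := fun n q => (Finset.univ.filter fun τ : Equiv.Perm (Fin n) =>
    (⟨n, τ⟩ : FinPerm) ∈ X ∧ st ⟨n, τ⟩ = q).card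
  let M : Matrix Q Q ℚ := fun q' q => ((Finset.univ.filter fun e => step q e q').card : ℚ)
  have hN : ∀ n q', N (n + 1) q' =
      ∑ q, (Finset.univ.filter fun e => step q e q').card * N n q := by
    intro n q'
    let A := Finset.univ.filter fun x : Equiv.Perm (Fin n) × Fin (D + 1) =>
      (⟨n, x.1⟩ : FinPerm) ∈ X ∧ step (st ⟨n, x.1⟩) x.2 q'
    have h1 : N (n + 1) q' = A.card := by
      symm
      refine Finset.card_bij (fun x _ => consPerm (Fin.ofNat (n + 1) x.2.1) x.1) ?_ ?_ ?_
      · rintro ⟨τ, e⟩ hx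
        obtain ⟨-, hx⟩ := (Finset.mem_filter.1 hx).2
        obtain ⟨e', he', hmem, hst⟩ := hstep n τ e q' hx
        -- The reduction modulo n + 1 is harmless, since an allowed step has e ≤ n.
        have : Fin.ofNat (n + 1) e.1 = e' := Fin.ext (by
          simp only [Fin.ofNat, ← he']
          exact Nat.mod_eq_of_lt e'.2)
        simp only [this]
        exact Finset.mem_filter.2 ⟨Finset.mem_univ _, hmem, hst⟩
      · rintro ⟨τ, e⟩ hx ⟨τ', e'⟩ hx' heq
        obtain ⟨-, hx⟩ := (Finset.mem_filter.1 hx).2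
        obtain ⟨-, hx'⟩ := (Finset.mem_filter.1 hx').2
        obtain ⟨f, hf, -⟩ := hstep n τ e q' hx
        obtain ⟨f', hf', -⟩ := hstep n τ' e' q' hx'
        have h := (consPerm_bijective n).1 (a₁ := (_, _)) (a₂ := (_, _)) heq
        rw [Prod.mk.injEq] at h
        have hv := congrArg Fin.val h.1
        have h3 := f.2
        have h4 := f'.2
        simp only at hv
        rw [Nat.mod_eq_of_lt (by omega), Nat.mod_eq_of_lt (by omega)] at hv
        exact Prod.ext h.2 (Fin.ext hv)
      · intro σ hσ
        obtain ⟨hmem, hst⟩ := (Finset.mem_filter.1 hσ).2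
        obtain ⟨⟨e, τ⟩, rfl⟩ := (consPerm_bijective n).2 σ
        have heD := hD n e τ hmem
        refine ⟨(τ, ⟨e.1, by omega⟩), Finset.mem_filter.2 ⟨Finset.mem_univ _,
          hX _ hmem _ (involved_consPerm e τ), n, τ, e, rfl, rfl, hmem, hst⟩, ?_⟩
        have : Fin.ofNat (n + 1) e.1 = e := Fin.ext (Nat.mod_eq_of_lt e.2)
        simp only [this]
    rw [h1, Finset.card_eq_sum_card_fiberwise (f := fun x => st ⟨n, x.1⟩) (t := Finset.univ)
      (fun _ _ => Finset.mem_coe.2 (Finset.mem_univ _))]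
    refine Finset.sum_congr rfl fun q _ => ?_
    rw [mul_comm, ← Finset.card_product]
    congr 1
    ext ⟨τ, e⟩
    simp only [A, Finset.mem_filter, Finset.mem_univ, true_and, Finset.mem_product]
    constructor
    · rintro ⟨⟨h2, h3⟩, rfl⟩
      exact ⟨⟨h2, rfl⟩, h3⟩
    · rintro ⟨⟨h2, rfl⟩, h3⟩
      exact ⟨⟨h2, h3⟩, rfl⟩
  obtain ⟨p, q, hq, h⟩ := rational_of_recurrence M (fun n q => (N n q : ℚ)) (fun n => by
    ext q'
    simp only [M, Matrix.mulVec, dotProduct]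
    rw [hN]
    push_cast
    rfl)
  refine ⟨p, q, hq, ?_⟩
  rw [← h]
  congr 2
  ext n
  rw [count, Nat.card_eq_fintype_card, Fintype.card_subtype,
    Finset.card_eq_sum_card_fiberwise (f := fun τ => st ⟨n, τ⟩) (t := Finset.univ)
      (fun _ _ => Finset.mem_coe.2 (Finset.mem_univ _))]
  push_cast
  refine Finset.sum_congr rfl fun q _ => ?_
  rw [Finset.filter_filter]

theorem IsUltimatelyPeriodic.exists_dispLE {π : Equiv.Perm ℕ} (h : IsUltimatelyPeriodic π) :
    ∃ D, DispLE π D := by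
  obtain ⟨N, P, hP, h⟩ := h
  let D := (Finset.range (N + P)).sup fun i => max i (π i)
  refine ⟨D, fun i => ?_⟩
  induction i using Nat.strong_induction_on with
  | _ i ih =>
    by_cases hi : i < N + P
    · have : max i (π i) ≤ D :=
        Finset.le_sup (f := fun i => max i (π i)) (Finset.mem_range.2 hi)
      omega
    · have h1 := h (i - P) (by omega)
      rw [Nat.sub_add_cancel (by omega)] at h1
      have h2 := ih (i - P) (by omega)
      omega

/-- The `e` smaller entries all come after the first one, and bounded displacement confines their
images to the next 2D positions. -/
theorem lehmer_le_of_dispLE {π : Equiv.Perm ℕ} {D : ℕ} (hD : DispLE π D) (n : ℕ) (e : Fin (n + 1))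
    (τ : Equiv.Perm (Fin n)) (h : (⟨n + 1, consPerm e τ⟩ : FinPerm) ∈ SubNat π) : e.1 ≤ 2 * D := by
  rw [subNat_eq_age] at h
  obtain ⟨f, -, hf⟩ := h
  change Fin (n + 1) → ℕ at f
  have h1 : (Finset.Iio e).card ≤ (Finset.Ioc (f 0) (f 0 + 2 * D)).card := by
    refine Finset.card_le_card_of_injOn (fun v => f ((consPerm e τ).symm v)) (fun v hv => ?_)
      (fun x _ y _ hxy => (consPerm e τ).symm.injective (hf.injective hxy))
    have hv : v < e := by simpa using hv
    have h2 := hf.2 ((consPerm e τ).symm v) 0 (by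
      simp only [Equiv.apply_symm_apply, consPerm_zero]; exact hv)
    have hne : (0 : Fin (n + 1)) ≠ (consPerm e τ).symm v := fun h0 => by
      have := congrArg (consPerm e τ) h0
      rw [consPerm_zero, Equiv.apply_symm_apply] at this
      exact hv.ne' this
    have h3 := hf.1 0 _ (lt_of_le_of_ne (Fin.zero_le _) hne)
    have h4 := hD (f 0)
    have h5 := hD (f ((consPerm e τ).symm v))
    simp only at h3
    simp only [Finset.coe_Ioc, Set.mem_Ioc]
    omega
  rw [Fin.card_Iio, Nat.card_Ioc] at h1
  omega

theorem IsUniquelyPeriodic.hasRationalGF {X : Set FinPerm} (hfb : IsFinitelyBased X)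
    (h : IsUniquelyPeriodic X) : HasRationalGF X := by
  obtain ⟨π, rfl, -, hπ⟩ := h
  obtain ⟨D, hD⟩ := hπ.exists_dispLE
  exact hasRationalGF_of_lehmer_bound (isClosedClass_subNat π) hfb (lehmer_le_of_dispLE hD)

end PermClass

/-! ### Assembly of the two alternatives -/

theorem theorem3p1 (X : Set PermClass.FinPerm)
    (hnat : PermClass.IsNaturalClass X) (hfb : PermClass.IsFinitelyBased X) :
    (((∃ γ : PermClass.FinPerm,
          X = PermClass.dsumSet (PermClass.Sub γ) (PermClass.Av (PermClass.finalComponents X))) ∧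
        PermClass.IsClosedClass (PermClass.Av (PermClass.finalComponents X)) ∧
        PermClass.IsSumComplete (PermClass.Av (PermClass.finalComponents X)) ∧
        (∀ (γ' : PermClass.FinPerm) (S' : Set PermClass.FinPerm),
          PermClass.IsClosedClass S' → PermClass.IsSumComplete S' →
          X = PermClass.dsumSet (PermClass.Sub γ') S' →
          S' = PermClass.Av (PermClass.finalComponents X))) ∨
      PermClass.IsUniquelyPeriodic X) ∧
    (PermClass.IsUniquelyPeriodic X → PermClass.HasRationalGF X) := by
  refine ⟨?_, fun h => h.hasRationalGF hfb⟩
  obtain ⟨π, hX⟩ := hnat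
  have hcl : PermClass.IsClosedClass X := hX ▸ PermClass.isClosedClass_subNat π
  have hne : X.Nonempty := hX ▸ PermClass.subNat_nonempty π
  by_cases hs : PermClass.Splits X
  · exact Or.inl ⟨hs, PermClass.isClosedClass_av _, PermClass.isSumComplete_av_finalComponents X,
      fun γ' S' hS hS' h => PermClass.eq_av_finalComponents hcl hS hS' h hne⟩
  · exact Or.inr ⟨π, hX, fun π' hX' => PermClass.eq_of_subNat_eq hX hfb hs hX',
      PermClass.isUltimatelyPeriodic_of_not_splits hX hfb hs⟩
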